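/- **Setting.** Let $(\Omega,\mathcal A,\mathbb P)$ be a probability space and $n,k,p,T,N,n_*,k_*,p_*,q_*,T_*\ge 0$ integers. Let $s_1,\dots,s_T$ be random regimes in $\{1,\dots,N\}$, $\mathsf P=(p_{ij})$ a random stochastic $N\times N$ matrix, and for each regime $j$ let $\Pi(j)=[A_0(j):A_1(j):\dots:A_p(j)]$ (with $A_0(j)\in\mathbb R^{n\times k}$, $A_i(j)\in\mathbb R^{n\times n}$) and $\Gamma(j)\in\mathbb R^{n_*\times(k_*+n_*(p_*+q_*))}$ be random matrices; put $\Pi_t:=\Pi(s_t)$, $A_{i,t}:=A_i(s_t)$, $\Gamma_t:=\Gamma(s_t)$. Write $\Pi$, $\Gamma$ for the collections $(\Pi(j))_{j\le N}$, $(\Gamma(j))_{j\le N}$ and $s=(s_1,\dots,s_T)$. Let $$y_t=\Pi_t\mathsf Y_{t-1}+\xi_t,\quad \mathsf Y_{t-1}=(\psi_t',y_{t-1}',\dots,y_{t-p}')',\quad \xi_t=\Sigma_t^{1/2}\varepsilon_t,\qquad t=1,\dots,T,$$ where $y_t\in\mathbb R^n$, $\psi_t\in\mathbb R^k$ are random vectors,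 $\Sigma_t$ is a random positive definite $n\times n$ matrix with Cholesky factor $\Sigma_t^{1/2}$, and $\varepsilon_1,\dots,\varepsilon_T$ are i.i.d. $\mathcal N(0,I_n)$. Let $\mathcal F_0$ be generated by $y_{1-p-T_*},\dots,y_0$, $\psi_{1-T_*},\dots,\psi_T$ and $\Sigma_{1-q_*},\dots,\Sigma_0$, and let $$\mathcal F_t=\mathcal F_0\vee\sigma(y_1,\dots,y_t),\qquad \mathcal H_t=\mathcal F_t\vee\sigma(\Pi)\vee\sigma(\Gamma)\vee\sigma(\mathsf P)\vee\sigma(s),$$ $$\mathcal I_{t-1}=\mathcal F_{t-1}\vee\sigma(\Pi_1,\dots,\Pi_t)\vee\sigma(\Gamma_1,\dots,\Gamma_t)\vee\sigma(\mathsf P)\vee\sigma(s_1,\dots,s_t).$$ Assume: $\Sigma_t$ is $\mathcal I_{t-1}$-measurable for $t=1,\dots,T$; $(\varepsilon_1,\dots,\varepsilon_T)$ is independent of $\mathcal F_0$ and, conditionally on $\mathcal F_0$, independent of $(\Pi,\Gamma,\mathsf P,s)$; $\mathsf P$ is independent of $(\Pi,\Gamma)$ given $\mathcal F_0$ and $s$;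 and $\mathbb P[s_{t+1}=j\mid s_1,\dots,s_t,\mathsf P,\mathcal F_0]=p_{s_tj}$ for $1\le t<T$. Let $\theta_t\in\mathbb R^n$ be $\mathcal I_{t-1}$-measurable with $$\theta_t=\Delta_{0,t}\psi_t+\Delta_{1,t}y_{t-1}+\dots+\Delta_{p,t}y_{t-p},\qquad t=1,\dots,T,$$ for $\mathcal H_t$-measurable random matrices $\Delta_{0,t}\in\mathbb R^{n\times k}$, $\Delta_{i,t}\in\mathbb R^{n\times n}$, and define the risk-neutral measure $\tilde{\mathbb P}$ by $$\frac{d\tilde{\mathbb P}}{d\mathbb P}=L_T=\prod_{m=1}^T\exp\Big\{\theta_m'\Sigma_m^{-1}\xi_m-\tfrac12\theta_m'\Sigma_m^{-1}\theta_m\Big\}.$$ Let $\Psi$ be the $nT\times nT$ matrix with $n\times n$ blocks $\Psi_{t,t}=I_n$, $\Psi_{t,t-i}=-(A_{i,t}+\Delta_{i,t})$ for $1\le i\le p$, $t-i\ge1$, and $0$ otherwise; let $\delta\in\mathbb R^{nT}$ have blocks $\delta_t=(A_{0,t}+\Delta_{0,t})\psi_t+\sum_{1\le i\le p,\ t-i\le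 0}(A_{i,t}+\Delta_{i,t})y_{t-i}$; let $\Sigma=\mathrm{diag}\{\Sigma_1,\dots,\Sigma_T\}$ and $y=(y_1',\dots,y_T')'$. For $0\le t\le T$ let $\bar y_t$, $\bar y_t^c$ be the sub-vectors of $y$ of times $\le t$ and $>t$, and let $\delta=\binom{\delta_1}{\delta_2}$, $\Psi=\begin{bmatrix}\Psi_{11}&0\\ \Psi_{21}&\Psi_{22}\end{bmatrix}$, $\Sigma=\mathrm{diag}\{\bar\Sigma_t,\bar\Sigma_t^c\}$ be the corresponding partitions, and $C_{21}=-\Psi_{22}^{-1}\Psi_{21}\Psi_{11}^{-1}$. "$X\mid\mathcal G\sim\mathcal N(a,S)$ under $\tilde{\mathbb P}$" means that $a,S$ are $\mathcal G$-measurable and $\mathcal N(a,S)$ is the conditional law of $X$ given $\mathcal G$ under $\tilde{\mathbb P}$. **Theorem.** $\tilde{\mathbb P}$ is a probability measure, and under $\tilde{\mathbb P}$: 1. $y\mid\mathcal H_0\sim\mathcal N\big(\Psi^{-1}\delta,\ \Psi^{-1}\Sigma(\Psi^{-1})'\big)$, provided $\Psi,\delta,\Sigma$ are $\mathcal H_0$-measurable;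 2. for $0\le t\le T$, $\bar y_t\mid\mathcal H_0\sim\mathcal N\big(\Psi_{11}^{-1}\delta_1,\ \Psi_{11}^{-1}\bar\Sigma_t(\Psi_{11}^{-1})'\big)$, provided $\Psi_{11},\delta_1,\bar\Sigma_t$ are $\mathcal H_0$-measurable; 3. for $0\le t\le T$, $\bar y_t^c\mid\mathcal H_0\sim\mathcal N\big(C_{21}\delta_1+\Psi_{22}^{-1}\delta_2,\ C_{21}\bar\Sigma_tC_{21}'+\Psi_{22}^{-1}\bar\Sigma_t^c(\Psi_{22}^{-1})'\big)$, provided $\Psi,\delta,\Sigma$ are $\mathcal H_0$-measurable; 4. for $0\le t\le T$, $\bar y_t^c\mid\mathcal H_t\sim\mathcal N\big(\Psi_{22}^{-1}(\delta_2-\Psi_{21}\bar y_t),\ \Psi_{22}^{-1}\bar\Sigma_t^c(\Psi_{22}^{-1})'\big)$, provided $\Psi_{21},\Psi_{22},\delta_2,\bar\Sigma_t^c$ are $\mathcal H_t$-measurable; 5. for $1\le t\le T$, $y_t\mid\mathcal H_{t-1}\sim\mathcal N\big(\Pi_t\mathsf Y_{t-1}+\theta_t,\ \Sigma_t\big)$.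 Moreover, the conditional law of $(s,\mathsf P)$ given $\mathcal F_0$ is the same under $\tilde{\mathbb P}$ and $\mathbb P$, and for every Borel set $B$, almost surely, $$\tilde{\mathbb P}\big[(\Pi,\Gamma)\in B\,\big|\,s,\mathsf P,\mathcal F_0\big]=\mathbb P\big[(\Pi,\Gamma)\in B\,\big|\,s,\mathcal F_0\big];$$ the same identity holds for the stacked matrices $[\Pi_1:\dots:\Pi_T]$, $[\Gamma_1:\dots:\Gamma_T]$ in place of $(\Pi,\Gamma)$. -/

import Mathlib

open MeasureTheory ProbabilityTheory Matrix

noncomputable section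

/-- Matrices carry the product (Borel) `σ`-algebra of their entries. -/
instance matrixMeasurableSpace {m n : Type*} : MeasurableSpace (Matrix m n ℝ) :=
  inferInstanceAs (MeasurableSpace (m → n → ℝ))

/-- The `σ`-fields `m₁` and `m₂` are conditionally independent given `m` under `μ`. -/
def CondIndepFields {Ω : Type*} {mΩ : MeasurableSpace Ω} (μ : Measure Ω)
    (m m₁ m₂ : MeasurableSpace Ω) : Prop :=
  ∀ A B : Set Ω, MeasurableSet[m₁] A → MeasurableSet[m₂] B →
    μ⟦A ∩ B | m⟧ =ᵐ[μ] μ⟦A | m⟧ * μ⟦B | m⟧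

/-- `X | 𝒢 ∼ N(a, S)` under `μ`, for a random mean vector `a` and a random covariance matrix `S`:
both are `𝒢`-measurable, and for every Borel set `B` the conditional probability of `X ∈ B`
given `𝒢` is almost surely the mass that `N(a, S)` gives to `B`. -/
def CondGaussian {Ω ι : Type*} [Fintype ι] [DecidableEq ι] {mΩ : MeasurableSpace Ω}
    (μ : Measure Ω) (𝒢 : MeasurableSpace Ω) (X : Ω → ι → ℝ) (a : Ω → ι → ℝ)
    (S : Ω → Matrix ι ι ℝ) : Prop :=
  Measurable[𝒢] a ∧ Measurable[𝒢] S ∧ (∀ ω, (S ω).PosSemidef) ∧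
    ∀ B : Set (EuclideanSpace ℝ ι), MeasurableSet B →
      μ⟦{ω | WithLp.toLp 2 (X ω) ∈ B} | 𝒢⟧ =ᵐ[μ]
        fun ω => (multivariateGaussian (WithLp.toLp 2 (a ω)) (S ω)).real B

/-- `L` is the Cholesky factor of `S`: lower triangular, with positive diagonal, `L L' = S`. -/
def IsCholeskyFactor {n : ℕ} (L S : Matrix (Fin n) (Fin n) ℝ) : Prop :=
  (∀ i j, i < j → L i j = 0) ∧ (∀ i, 0 < L i i) ∧ L * Lᵀ = S

/-- The times `a, a + 1, …, b`. -/
abbrev Times (a b : ℤ) : Type := {t : ℤ // t ∈ Finset.Icc a b}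

/-- Columns of an autoregressive coefficient matrix `[A₀ : A₁ : ⋯ : A_p]`: first the `k` columns
of `A₀`, then, for each lag `i = 1, …, p` (represented by `i - 1 : Fin p`), the `n` columns
of `A_i`. -/
abbrev Cols (k p n : ℕ) : Type := Fin k ⊕ (Fin p × Fin n)

/-- The random objects of a Bayesian Markov-switching VAR(`p`) process with `n` variables, `k`
exogenous variables, horizon `T`, `N` regimes, volatility coefficients of sizes `n'`, `k'`,
`p'`, `q'`, and data from `Tpast` periods before time 1 (`Tpast = 0`: no such data). Times are
integers; only `y_t` for `1 - p - Tpast ≤ t ≤ T`, `ψ_t` for `1 - Tpast ≤ t ≤ T`, `Σ_t` for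
`1 - q' ≤ t ≤ T`, and the other processes for `1 ≤ t ≤ T` play a role. -/
structure MSVAR (Ω : Type*) (n k p T N n' k' p' q' Tpast : ℕ) where
  /-- the process `y_t` -/
  y : ℤ → Ω → Fin n → ℝ
  /-- the exogenous variables `ψ_t` -/
  psi : ℤ → Ω → Fin k → ℝ
  /-- the covariance matrices `Σ_t` -/
  Sig : ℤ → Ω → Matrix (Fin n) (Fin n) ℝ
  /-- the Cholesky factors of the `Σ_t` -/
  chol : ℤ → Ω → Matrix (Fin n) (Fin n) ℝ
  /-- the white noise `ε_t` -/
  eps : ℤ → Ω → Fin n → ℝ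
  /-- the regimes `s_t` -/
  s : ℤ → Ω → Fin N
  /-- the random transition probability matrix -/
  trans : Ω → Matrix (Fin N) (Fin N) ℝ
  /-- the coefficient matrix `Π(j) = [A₀(j) : ⋯ : A_p(j)]` of regime `j` -/
  Pi : Fin N → Ω → Matrix (Fin n) (Cols k p n) ℝ
  /-- the coefficient matrix `Γ(j) = [B₀(j) : ⋯ : B_{p' + q'}(j)]` of regime `j` -/
  Gam : Fin N → Ω → Matrix (Fin n') (Cols k' (p' + q') n') ℝ

namespace MSVAR

variable {Ω : Type*} {n k p T N n' k' p' q' Tpast : ℕ}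
  (M : MSVAR Ω n k p T N n' k' p' q' Tpast)

/-- `Π_t = Π(s_t)`. -/
def PiAt (t : ℤ) (ω : Ω) : Matrix (Fin n) (Cols k p n) ℝ := M.Pi (M.s t ω) ω

/-- `Γ_t = Γ(s_t)`. -/
def GamAt (t : ℤ) (ω : Ω) : Matrix (Fin n') (Cols k' (p' + q') n') ℝ := M.Gam (M.s t ω) ω

/-- `lagged t` is the vector `Y_{t-1} = (ψ_t', y_{t-1}', …, y_{t-p}')'`. -/
def lagged (t : ℤ) (ω : Ω) : Cols k p n → ℝ :=
  Sum.elim (M.psi t ω) (fun c => M.y (t - ((c.1 : ℕ) + 1 : ℤ)) ω c.2)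

/-- The residual `ξ_t = Σ_t^{1/2} ε_t`. -/
def xi (t : ℤ) (ω : Ω) : Fin n → ℝ := M.chol t ω *ᵥ M.eps t ω

/-- The regime vector `s = (s_1, …, s_T)`. -/
def sVec (ω : Ω) : Times 1 T → Fin N := fun t => M.s t ω

/-- The initial information `𝓕_0`. -/
@[reducible] def F0 : MeasurableSpace Ω :=
  (⨆ t ∈ Finset.Icc (1 - (p : ℤ) - Tpast) 0, MeasurableSpace.comap (M.y t) inferInstance) ⊔
  (⨆ t ∈ Finset.Icc (1 - (Tpast : ℤ)) T, MeasurableSpace.comap (M.psi t) inferInstance) ⊔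
  (⨆ t ∈ Finset.Icc (1 - (q' : ℤ)) 0, MeasurableSpace.comap (M.Sig t) inferInstance)

/-- `𝓕_t = 𝓕_0 ∨ σ(y_1, …, y_t)`. -/
@[reducible] def F (t : ℤ) : MeasurableSpace Ω :=
  M.F0 ⊔ ⨆ u ∈ Finset.Icc 1 t, MeasurableSpace.comap (M.y u) inferInstance

/-- `σ(s_1, …, s_t)`. -/
@[reducible] def sigmaRegimes (t : ℤ) : MeasurableSpace Ω :=
  ⨆ u ∈ Finset.Icc 1 t, MeasurableSpace.comap (M.s u) inferInstance

/-- The `σ`-field of the transition matrix. -/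
@[reducible] def sigmaTrans : MeasurableSpace Ω := MeasurableSpace.comap M.trans inferInstance

/-- `σ(Π) ∨ σ(Γ)`, for the coefficient matrices of all regimes. -/
@[reducible] def sigmaCoeff : MeasurableSpace Ω :=
  (⨆ j, MeasurableSpace.comap (M.Pi j) inferInstance) ⊔
  (⨆ j, MeasurableSpace.comap (M.Gam j) inferInstance)

/-- `σ(ε_1, …, ε_T)`. -/
@[reducible] def sigmaNoise : MeasurableSpace Ω :=
  ⨆ t ∈ Finset.Icc (1 : ℤ) T, MeasurableSpace.comap (M.eps t) inferInstance

/-- `𝓗_t = 𝓕_t ∨ σ(Π) ∨ σ(Γ) ∨ σ(P) ∨ σ(s)`. -/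
@[reducible] def H (t : ℤ) : MeasurableSpace Ω :=
  M.F t ⊔ M.sigmaCoeff ⊔ M.sigmaTrans ⊔ M.sigmaRegimes T

/-- `IBefore t` is `𝓘_{t-1} = 𝓕_{t-1} ∨ σ(Π_1, …, Π_t) ∨ σ(Γ_1, …, Γ_t) ∨ σ(P) ∨ σ(s_1, …, s_t)`. -/
@[reducible] def IBefore (t : ℤ) : MeasurableSpace Ω :=
  M.F (t - 1) ⊔
  (⨆ u ∈ Finset.Icc 1 t, MeasurableSpace.comap (M.PiAt u) inferInstance) ⊔
  (⨆ u ∈ Finset.Icc 1 t, MeasurableSpace.comap (M.GamAt u) inferInstance) ⊔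
  M.sigmaTrans ⊔ M.sigmaRegimes t

/-- The assumptions of the Bayesian MS-VAR(`p`) model under the real-world measure `μ`. -/
structure IsModel [mΩ : MeasurableSpace Ω] (μ : Measure Ω) : Prop where
  measurable_y : ∀ t, Measurable (M.y t)
  measurable_psi : ∀ t, Measurable (M.psi t)
  measurable_Sig : ∀ t, Measurable (M.Sig t)
  measurable_eps : ∀ t, Measurable (M.eps t)
  measurable_s : ∀ t, Measurable (M.s t)
  measurable_trans : Measurable M.trans
  measurable_Pi : ∀ j, Measurable (M.Pi j)
  measurable_Gam : ∀ j, Measurable (M.Gam j)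
  /-- `y_t = Π_t Y_{t-1} + ξ_t` -/
  equation : ∀ t ∈ Finset.Icc (1 : ℤ) T, ∀ ω,
    M.y t ω = M.PiAt t ω *ᵥ M.lagged t ω + M.xi t ω
  /-- `Σ_t` is positive definite and `𝓘_{t-1}`-measurable -/
  posDef : ∀ t ∈ Finset.Icc (1 : ℤ) T, ∀ ω, (M.Sig t ω).PosDef
  predictable : ∀ t ∈ Finset.Icc (1 : ℤ) T, Measurable[M.IBefore t] (M.Sig t)
  cholesky : ∀ t ∈ Finset.Icc (1 : ℤ) T, ∀ ω, IsCholeskyFactor (M.chol t ω) (M.Sig t ω)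
  /-- `ε_1, …, ε_T` are independent and `N(0, I_n)` -/
  noise_law : ∀ t ∈ Finset.Icc (1 : ℤ) T,
    HasLaw (fun ω => WithLp.toLp 2 (M.eps t ω)) (multivariateGaussian 0 1) μ
  noise_indep : iIndepFun (fun (t : Times 1 T) => M.eps t) μ
  /-- the noise is independent of the initial information … -/
  noise_indep_init : Indep M.sigmaNoise M.F0 μ
  /-- … and, conditionally on it, of the coefficients, the transition matrix and the regimes -/
  noise_condIndep : CondIndepFields μ M.F0 M.sigmaNoise
    (M.sigmaCoeff ⊔ M.sigmaTrans ⊔ M.sigmaRegimes T)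
  /-- the transition matrix is independent of `(Π, Γ)` given `𝓕_0` and `s` -/
  trans_condIndep : CondIndepFields μ (M.F0 ⊔ M.sigmaRegimes T) M.sigmaTrans M.sigmaCoeff
  /-- the transition matrix is a stochastic matrix -/
  trans_stochastic : ∀ ω i, (∀ j, 0 ≤ M.trans ω i j) ∧ ∑ j, M.trans ω i j = 1
  /-- given the transition matrix and `𝓕_0`, the regimes form a homogeneous Markov chain -/
  markov : ∀ t ∈ Finset.Icc (1 : ℤ) (T - 1), ∀ j,
    μ⟦{ω | M.s (t + 1) ω = j} | M.F0 ⊔ M.sigmaTrans ⊔ M.sigmaRegimes t⟧ =ᵐ[μ]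
      fun ω => M.trans ω (M.s t ω) j

section Girsanov

variable (θ : ℤ → Ω → Fin n → ℝ) (Δ : ℤ → Ω → Matrix (Fin n) (Cols k p n) ℝ)

/-- The state price density
`L_t = ∏_{m=1}^t exp(θ_m' Σ_m⁻¹ ξ_m - ½ θ_m' Σ_m⁻¹ θ_m)`. -/
def stateDensity (t : ℤ) (ω : Ω) : ℝ :=
  ∏ m ∈ Finset.Icc 1 t, Real.exp (θ m ω ⬝ᵥ ((M.Sig m ω)⁻¹ *ᵥ M.xi m ω)
    - 1 / 2 * (θ m ω ⬝ᵥ ((M.Sig m ω)⁻¹ *ᵥ θ m ω)))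

/-- The risk-neutral measure, with density `L_T` with respect to `μ`. -/
def riskNeutral [MeasurableSpace Ω] (μ : Measure Ω) : Measure Ω :=
  μ.withDensity (fun ω => ENNReal.ofReal (M.stateDensity θ T ω))

/-- `θ` is a Girsanov kernel that is linear in past values: `θ_t` is `𝓘_{t-1}`-measurable and
`θ_t = Δ_{0,t} ψ_t + Δ_{1,t} y_{t-1} + ⋯ + Δ_{p,t} y_{t-p}` with
`Δ_t = [Δ_{0,t} : ⋯ : Δ_{p,t}]` being `𝓗_t`-measurable. -/
def IsLinearKernel : Prop :=
  ∀ t ∈ Finset.Icc (1 : ℤ) T, Measurable[M.IBefore t] (θ t) ∧ Measurable[M.H t] (Δ t) ∧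
    ∀ ω, θ t ω = Δ t ω *ᵥ M.lagged t ω

/-- The `(t, u)` block of the matrix `Ψ` for times `t`, `u`: `I_n` if `u = t`,
`-(A_{i,t} + Δ_{i,t})` if `u = t - i` with `1 ≤ i ≤ p`, and `0` otherwise. -/
def psiBlock (ω : Ω) (t u : ℤ) : Matrix (Fin n) (Fin n) ℝ :=
  if u = t then 1
  else if h : 1 ≤ t - u ∧ t - u ≤ p then
    -Matrix.of fun i j =>
      (M.PiAt t ω + Δ t ω) i (Sum.inr (⟨(t - u - 1).toNat, by omega⟩, j))
  else 0

/-- The block of `δ` at time `t`: `(A_{0,t} + Δ_{0,t}) ψ_t` plus the sum of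
`(A_{i,t} + Δ_{i,t}) y_{t-i}` over the lags `1 ≤ i ≤ p` with `t - i ≤ 0`. -/
def deltaBlock (ω : Ω) (t : ℤ) : Fin n → ℝ :=
  (M.PiAt t ω + Δ t ω) *ᵥ Sum.elim (M.psi t ω)
    (fun c => if t - ((c.1 : ℕ) + 1 : ℤ) ≤ 0 then M.y (t - ((c.1 : ℕ) + 1 : ℤ)) ω c.2 else 0)

/-- The submatrix of `Ψ` with the block rows of times `a, …, b` and the block columns of
times `c, …, d`. The matrix `Ψ` itself is the case `a = c = 1`, `b = d = T`. -/
def Psi (a b c d : ℤ) (ω : Ω) : Matrix (Times a b × Fin n) (Times c d × Fin n) ℝ :=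
  Matrix.of fun r q => M.psiBlock Δ ω r.1 q.1 r.2 q.2

/-- The blocks `a, …, b` of `δ`, stacked. -/
def delta (a b : ℤ) (ω : Ω) : Times a b × Fin n → ℝ := fun r => M.deltaBlock Δ ω r.1 r.2

/-- `C₂₁ = -Ψ₂₂⁻¹ Ψ₂₁ Ψ₁₁⁻¹` for the partition of `Ψ` after time `t`. -/
def C21 (t : ℤ) (ω : Ω) : Matrix (Times (t + 1) T × Fin n) (Times 1 t × Fin n) ℝ :=
  -((M.Psi Δ (t + 1) T (t + 1) T ω)⁻¹ * M.Psi Δ (t + 1) T 1 t ω * (M.Psi Δ 1 t 1 t ω)⁻¹)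

end Girsanov

/-- `diag(Σ_a, …, Σ_b)`. -/
def SigDiag (a b : ℤ) (ω : Ω) : Matrix (Times a b × Fin n) (Times a b × Fin n) ℝ :=
  Matrix.of fun r q => if r.1 = q.1 then M.Sig r.1 ω r.2 q.2 else 0

/-- `(y_a', …, y_b')'`. -/
def yStack (a b : ℤ) (ω : Ω) : Times a b × Fin n → ℝ := fun r => M.y r.1 ω r.2

end MSVAR

end

/-! Put η_t = Σ_t^{-1/2} θ_t. Since Σ_t is the product of its Cholesky factor with its transpose,
the factor of the density at time t is exp(η_t'ε_t - ½ η_t'η_t), where η_t is known at time t - 1.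
The noise is independent of 𝓗_0, because it is independent of 𝓕_0 and, given 𝓕_0, of all the rest of
𝓗_0. The model equation recovers 𝓗_{t-1} from 𝓗_0 and ε_1, …, ε_{t-1}, so ε_t is standard normal
given 𝓗_{t-1} (`isStdNormalGiven_eps`). The Cameron–Martin formula, applied one time step after
another (`IsModel.lintegral_girsanov`), shows that under the risk-neutral measure the shifted noise
ε̃_u = ε_u - η_u, u > t, is a standard normal vector given 𝓗_t (`isStdNormalGiven_epsTilde`). It
also shows that the two measures agree on 𝓗_0.

The Gaussian laws are then linear algebra. As Σ_t^{1/2} η_t = θ_t is linear in the lagged vector,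
the model becomes Ψ y = δ + Σ^{1/2} ε̃, where Ψ is block lower triangular with identity diagonal
blocks, hence invertible. Solving for the wanted block presents it as a + B Z with Z standard normal
given the conditioning σ-field and a, B measurable for it, and `IsStdNormalGiven.condGaussian` gives
N(a, BB').

The regimes, the transition matrix and the coefficients are 𝓗_0-measurable, so their conditional
probabilities given smaller σ-fields are the same under both measures. Conditional independence then
removes the transition matrix from the conditioning. The stacked matrices also depend on s, so they
are treated separately on each of the finitely many values of s. -/

/-! ### Independence and joins of σ-fields -/

lemma generateFrom_inter_eq_sup {Ω : Type*} (m₁ m₂ : MeasurableSpace Ω) :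
    MeasurableSpace.generateFrom
      {s | ∃ A B, MeasurableSet[m₁] A ∧ MeasurableSet[m₂] B ∧ s = A ∩ B} = m₁ ⊔ m₂ := by
  apply le_antisymm
  · refine MeasurableSpace.generateFrom_le ?_
    rintro _ ⟨A, B, hA, hB, rfl⟩
    exact MeasurableSet.inter (m := m₁ ⊔ m₂) ((le_sup_left : m₁ ≤ m₁ ⊔ m₂) _ hA)
      ((le_sup_right : m₂ ≤ m₁ ⊔ m₂) _ hB)
  · refine sup_le (fun A hA => ?_) (fun B hB => ?_)
    · exact MeasurableSpace.measurableSet_generateFrom ⟨A, Set.univ, hA, MeasurableSet.univ, by simp⟩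
    · exact MeasurableSpace.measurableSet_generateFrom ⟨Set.univ, B, MeasurableSet.univ, hB, by simp⟩

lemma isPiSystem_inter_measurableSets {Ω : Type*} (m₁ m₂ : MeasurableSpace Ω) :
    IsPiSystem {s | ∃ A B, MeasurableSet[m₁] A ∧ MeasurableSet[m₂] B ∧ s = A ∩ B} := by
  rintro _ ⟨A, B, hA, hB, rfl⟩ _ ⟨A', B', hA', hB', rfl⟩ -
  exact ⟨A ∩ A', B ∩ B', MeasurableSet.inter hA hA', MeasurableSet.inter hB hB',
    Set.inter_inter_inter_comm _ _ _ _⟩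

/-- To prove that `m₁` is independent of `m₂ ∨ m₃`, it suffices to test intersections. -/
lemma indep_sup_right_of_inter {Ω : Type*} {m₁ m₂ m₃ mΩ : MeasurableSpace Ω}
    {μ : Measure Ω} [IsProbabilityMeasure μ] (h₁ : m₁ ≤ mΩ) (h₂ : m₂ ≤ mΩ)
    (h₃ : m₃ ≤ mΩ)
    (h : ∀ A B C, MeasurableSet[m₁] A → MeasurableSet[m₂] B → MeasurableSet[m₃] C →
      μ (A ∩ (B ∩ C)) = μ A * μ (B ∩ C)) : Indep m₁ (m₂ ⊔ m₃) μ := by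
  refine IndepSets.indep h₁ (sup_le h₂ h₃) (@MeasurableSpace.isPiSystem_measurableSet _ m₁)
    (isPiSystem_inter_measurableSets m₂ m₃) (@MeasurableSpace.generateFrom_measurableSet _ m₁).symm
    (generateFrom_inter_eq_sup m₂ m₃).symm ?_
  rw [IndepSets_iff]
  rintro A _ hA ⟨B, C, hB, hC, rfl⟩
  exact h A B C hA hB hC

/-- Both sides factor completely on intersections: μ(A ∩ B ∩ C) = μ(A ∩ B) μ(C) = μ(A) μ(B) μ(C) =
μ(A) μ(B ∩ C). It is meant for the current noise, the past noise and 𝓗_0. -/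
lemma Indep.sup_right_of_sup_left {Ω : Type*} {m₁ m₂ m₃ mΩ : MeasurableSpace Ω}
    {μ : Measure Ω} [IsProbabilityMeasure μ] (h₁ : m₁ ≤ mΩ) (h₂ : m₂ ≤ mΩ)
    (h₃ : m₃ ≤ mΩ) (h₁₂ : Indep m₁ m₂ μ) (h : Indep (m₁ ⊔ m₂) m₃ μ) :
    Indep m₁ (m₂ ⊔ m₃) μ := by
  refine indep_sup_right_of_inter h₁ h₂ h₃ fun A B C hA hB hC => ?_
  have hB' := (le_sup_right : m₂ ≤ m₁ ⊔ m₂) _ hB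
  have hA' := (le_sup_left : m₁ ≤ m₁ ⊔ m₂) _ hA
  rw [Indep_iff] at h h₁₂
  rw [← Set.inter_assoc, h _ _ (MeasurableSet.inter hA' hB') hC, h _ _ hB' hC, h₁₂ _ _ hA hB,
    mul_assoc]

/-- If `m₁` is independent of `m` and, given `m`, of `m₂`, then it is independent of `m ∨ m₂`. -/
lemma CondIndepFields.indep_sup {Ω : Type*} {m m₁ m₂ mΩ : MeasurableSpace Ω}
    {μ : Measure Ω} [IsProbabilityMeasure μ] (hm : m ≤ mΩ) (h₁ : m₁ ≤ mΩ)
    (h₂ : m₂ ≤ mΩ) (hc : CondIndepFields μ m m₁ m₂) (hi : Indep m₁ m μ) :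
    Indep m₁ (m ⊔ m₂) μ := by
  refine indep_sup_right_of_inter h₁ hm h₂ fun A B C hA hB hC => ?_
  have hA0 : MeasurableSet A := h₁ _ hA
  have hB0 : MeasurableSet B := hm _ hB
  have hC0 : MeasurableSet C := h₂ _ hC
  have hint : ∀ S : Set Ω, MeasurableSet S → Integrable (S.indicator fun _ => (1 : ℝ)) μ :=
    fun S hS => (integrable_const _).indicator hS
  have key : ∀ S : Set Ω, MeasurableSet S → ∫ ω in B, (μ⟦S | m⟧) ω ∂μ = μ.real (S ∩ B) := by
    intro S hS
    rw [setIntegral_condExp hm (hint S hS) hB, integral_indicator_const _ hS]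
    simp [measureReal_restrict_apply hS]
  have hcA : μ⟦A | m⟧ =ᵐ[μ] fun _ => μ.real A := by
    have := condExp_indep_eq h₁ hm
      (stronglyMeasurable_const.indicator hA : StronglyMeasurable[m₁] (A.indicator fun _ => (1 : ℝ))) hi
    rwa [integral_indicator_const _ hA0, smul_eq_mul, mul_one] at this
  -- Integrate the conditional product formula over `B`; independence of `m₁` and `m` makes the
  -- factor μ⟦A | m⟧ the constant μ(A).
  have e : μ.real ((A ∩ C) ∩ B) = μ.real A * μ.real (C ∩ B) := by
    rw [← key _ (hA0.inter hC0), ← key _ hC0, ← integral_const_mul]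
    refine setIntegral_congr_ae hB0 ?_
    filter_upwards [hc A C hA hC, hcA] with ω h h' _
    rw [h, Pi.mul_apply, h']
  rw [show A ∩ (B ∩ C) = (A ∩ C) ∩ B by ext; simp; tauto, Set.inter_comm B C]
  rw [← ENNReal.toReal_eq_toReal_iff' (by finiteness) (by finiteness), ENNReal.toReal_mul]
  exact e

/-! ### Conditionally standard normal vectors -/

/-- Conditionally on `𝒢`, the vector `Z` is standard normal: it has independent standard normal
coordinates and is independent of `𝒢`. -/
def IsStdNormalGiven {Ω κ : Type*} [Fintype κ] (𝒢 : MeasurableSpace Ω)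
    {mΩ : MeasurableSpace Ω} (Q : Measure Ω) (Z : Ω → κ → ℝ) : Prop :=
  Measurable Z ∧ ∀ A, MeasurableSet[𝒢] A → ∀ B : κ → Set ℝ, (∀ i, MeasurableSet (B i)) →
    Q (A ∩ {ω | ∀ i, Z ω i ∈ B i}) = Q A * ∏ i, gaussianReal 0 1 (B i)

namespace IsStdNormalGiven

variable {Ω κ κ' : Type*} [Fintype κ] [Fintype κ'] {𝒢 mΩ : MeasurableSpace Ω}
    {Q : Measure Ω} {Z : Ω → κ → ℝ}

lemma comp_injective (h : IsStdNormalGiven 𝒢 Q Z) {e : κ' → κ} (he : Function.Injective e) :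
    IsStdNormalGiven 𝒢 Q (fun ω i => Z ω (e i)) := by
  classical
  refine ⟨measurable_pi_lambda _ fun i => (measurable_pi_apply (e i)).comp h.1,
    fun A hA B hB => ?_⟩
  -- Intersecting over the fibre of `e` avoids an inverse: this is `B i` at `e i`, and the whole
  -- line, of mass 1, off the range of `e`.
  let B' : κ → Set ℝ := fun j => {x | ∀ i, e i = j → x ∈ B i}
  have hB' : ∀ i, B' (e i) = B i := fun i => by
    ext x
    exact ⟨fun hx => hx i rfl, fun hx i' hi' => he hi' ▸ hx⟩
  have hBu : ∀ j, j ∉ Set.range e → B' j = Set.univ := fun j hj => by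
    ext x
    simp only [B', Set.mem_ofPred_eq, Set.mem_univ, iff_true]
    exact fun i hi => (hj ⟨i, hi⟩).elim
  have hm : ∀ j, MeasurableSet (B' j) := fun j => by
    by_cases hj : j ∈ Set.range e
    · obtain ⟨i, rfl⟩ := hj
      rw [hB']
      exact hB i
    · rw [hBu j hj]
      exact MeasurableSet.univ
  have h1 := h.2 A hA B' hm
  have h2 : {ω | ∀ j, Z ω j ∈ B' j} = {ω | ∀ i, Z ω (e i) ∈ B i} := by
    ext ω
    refine ⟨fun hω i => hω (e i) i rfl, fun hω j i hi => hi ▸ hω i⟩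
  have h3 : ∏ j, gaussianReal 0 1 (B' j) = ∏ i, gaussianReal 0 1 (B i) := by
    rw [← Finset.prod_subset (Finset.subset_univ (Finset.univ.image e)),
      Finset.prod_image (fun i _ j _ hij => he hij)]
    · simp_rw [hB']
    · intro j _ hj
      rw [hBu j (by simpa using hj)]
      simp
  rw [h2, h3] at h1
  exact h1

lemma measure_inter_preimage [IsFiniteMeasure Q] (h : IsStdNormalGiven 𝒢 Q Z) (h𝒢 : 𝒢 ≤ mΩ)
    {A : Set Ω} (hA : MeasurableSet[𝒢] A) {E : Set (κ → ℝ)} (hE : MeasurableSet E) :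
    Q (A ∩ Z ⁻¹' E) = Q A * Measure.pi (fun _ : κ => gaussianReal 0 1) E := by
  have hA0 := h𝒢 _ hA
  have key : (Q.restrict A).map Z = Q A • Measure.pi (fun _ : κ => gaussianReal 0 1) := by
    refine ext_of_generate_finite _ generateFrom_pi.symm isPiSystem_pi ?_ ?_
    · rintro _ ⟨B, hB, rfl⟩
      have hB' : ∀ i, MeasurableSet (B i) := fun i => hB i (Set.mem_univ i)
      have hm : MeasurableSet (Set.univ.pi B) := MeasurableSet.univ_pi hB'
      rw [Measure.map_apply h.1 hm, Measure.restrict_apply (h.1 hm), Set.inter_comm,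
        Measure.smul_apply, Measure.pi_pi, smul_eq_mul, ← h.2 A hA B hB']
      congr 1
      ext ω
      simp
    · rw [Measure.map_apply h.1 MeasurableSet.univ]
      simp
  have := congrArg (fun ν => ν E) key
  simp only [Measure.smul_apply, smul_eq_mul] at this
  rw [← this, Measure.map_apply h.1 hE, Measure.restrict_apply (h.1 hE), Set.inter_comm]

/-- Integrating out a conditionally standard normal vector. -/
lemma lintegral_eq [IsFiniteMeasure Q] (h : IsStdNormalGiven 𝒢 Q Z) (h𝒢 : 𝒢 ≤ mΩ)
    {f : Ω × (κ → ℝ) → ENNReal} (hf : Measurable[𝒢.prod inferInstance] f) :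
    ∫⁻ ω, f (ω, Z ω) ∂Q =
      ∫⁻ ω, ∫⁻ z, f (ω, z) ∂(Measure.pi fun _ : κ => gaussianReal 0 1) ∂Q := by
  have hid : Measurable[mΩ, 𝒢] (id : Ω → Ω) := measurable_id'' h𝒢
  have hZ : Measurable[mΩ, 𝒢.prod inferInstance] (fun ω => (ω, Z ω)) :=
    hid.prodMk h.1
  -- Both measures live on the product of `𝒢` with the Borel sets, with `Q` trimmed to `𝒢`. Only
  -- rectangles with a `𝒢`-measurable side factorize, which is why `f` must be measurable for this
  -- product.
  have key : @Measure.map _ _ mΩ (𝒢.prod inferInstance) (fun ω => (ω, Z ω)) Q =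
      @Measure.prod _ _ 𝒢 _ (Q.trim h𝒢) (Measure.pi fun _ : κ => gaussianReal 0 1) := by
    symm
    refine @Measure.prod_eq _ _ 𝒢 _ _ _ _ _ _ fun A E hA hE => ?_
    rw [Measure.map_apply hZ (@MeasurableSet.prod _ _ 𝒢 _ _ _ hA hE), trim_measurableSet_eq h𝒢 hA,
      ← h.measure_inter_preimage h𝒢 hA hE]
    rfl
  rw [← @lintegral_map _ _ mΩ (𝒢.prod inferInstance) Q f _ hf hZ, key,
    @lintegral_prod _ _ 𝒢 _ _ _ _ _ hf.aemeasurable, lintegral_trim h𝒢]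
  exact @Measurable.lintegral_prod_right' _ _ 𝒢 _ _ _ _ hf

end IsStdNormalGiven

lemma isStdNormalGiven_of_indep {Ω κ : Type*} [Fintype κ] {𝒢 mΩ : MeasurableSpace Ω}
    {μ : Measure Ω} {Z : Ω → κ → ℝ} (hZ : Measurable Z)
    (hlaw : μ.map Z = Measure.pi fun _ : κ => gaussianReal 0 1)
    (hi : Indep (MeasurableSpace.comap Z inferInstance) 𝒢 μ) : IsStdNormalGiven 𝒢 μ Z := by
  refine ⟨hZ, fun A hA B hB => ?_⟩
  have hm : MeasurableSet (Set.univ.pi B) := MeasurableSet.univ_pi hB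
  have he : {ω | ∀ i, Z ω i ∈ B i} = Z ⁻¹' (Set.univ.pi B) := by ext; simp
  rw [Indep_iff] at hi
  rw [he, Set.inter_comm, hi _ _ ⟨_, hm, rfl⟩ hA, ← Measure.map_apply hZ hm, hlaw, Measure.pi_pi,
    mul_comm]

lemma HasLaw.map_eq_pi_gaussianReal {Ω κ : Type*} [Fintype κ] [DecidableEq κ]
    {mΩ : MeasurableSpace Ω} {μ : Measure Ω} {Z : Ω → κ → ℝ} (hZ : Measurable Z)
    (h : HasLaw (fun ω => WithLp.toLp 2 (Z ω)) (multivariateGaussian 0 1) μ) :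
    μ.map Z = Measure.pi fun _ : κ => gaussianReal 0 1 := by
  have h1 := h.map_eq
  rw [multivariateGaussian_zero_one, ← map_pi_eq_stdGaussian] at h1
  have h2 := congrArg (fun ν => Measure.map (WithLp.ofLp (p := 2)) ν) h1
  rw [Measure.map_map (by fun_prop) (by fun_prop), Measure.map_map (by fun_prop) (by fun_prop)] at h2
  simpa [Function.comp_def] using h2

/-- The affine image `a + B Z` of a standard normal vector has law `N(a, B B')`. -/
lemma map_affine_pi_gaussianReal {κ ι : Type*} [Fintype κ] [Fintype ι] [DecidableEq ι]
    (a : ι → ℝ) (B : Matrix ι κ ℝ) :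
    (Measure.pi fun _ : κ => gaussianReal 0 1).map (fun z => WithLp.toLp 2 (a + B *ᵥ z)) =
      multivariateGaussian (WithLp.toLp 2 a) (B * Bᵀ) := by
  have hS : (B * Bᵀ).PosSemidef := by
    simpa [conjTranspose_eq_transpose_of_trivial] using posSemidef_self_mul_conjTranspose B
  have hm : Measurable (fun z : κ → ℝ => WithLp.toLp 2 (a + B *ᵥ z)) := by
    refine (WithLp.measurable_toLp 2 _).comp (measurable_const.add ?_)
    exact (Continuous.matrix_mulVec continuous_const continuous_id).measurable
  have := Measure.isProbabilityMeasure_map (μ := Measure.pi fun _ : κ => gaussianReal 0 1)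
    hm.aemeasurable
  apply Measure.ext_of_charFun
  ext t
  rw [charFun_multivariateGaussian hS, charFun_apply,
    integral_map hm.aemeasurable (Measurable.aestronglyMeasurable (by fun_prop))]
  -- The characteristic function of a + Bz at t is a phase times that of z at B't, and |B't|² =
  -- t'BB't.
  have hstd := charFun_stdGaussian (E := EuclideanSpace ℝ κ) (WithLp.toLp 2 (Bᵀ *ᵥ t.ofLp))
  rw [← map_pi_eq_stdGaussian, charFun_apply, integral_map (by fun_prop)
    (Measurable.aestronglyMeasurable (by fun_prop))] at hstd
  have e : ∀ z : κ → ℝ, Complex.exp (inner ℝ (WithLp.toLp 2 (a + B *ᵥ z)) t * Complex.I) =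
      Complex.exp (inner ℝ t (WithLp.toLp 2 a) * Complex.I) *
        Complex.exp (inner ℝ (WithLp.toLp 2 z) (WithLp.toLp 2 (Bᵀ *ᵥ t.ofLp)) * Complex.I) := by
    intro z
    rw [← Complex.exp_add, ← add_mul, ← Complex.ofReal_add]
    congr 3
    simp only [EuclideanSpace.inner_eq_star_dotProduct, star_trivial, dotProduct_add]
    rw [dotProduct_comm, dotProduct_mulVec, ← mulVec_transpose]
  simp_rw [e]
  rw [integral_const_mul, hstd, ← Complex.exp_add]
  congr 1
  have hn : ‖WithLp.toLp 2 (Bᵀ *ᵥ t.ofLp)‖ ^ 2 = t.ofLp ⬝ᵥ (B * Bᵀ) *ᵥ t.ofLp := by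
    rw [EuclideanSpace.real_norm_sq_eq, ← mulVec_mulVec, dotProduct_mulVec, ← mulVec_transpose]
    simp [dotProduct, sq]
  rw [← hn]
  push_cast
  ring

/-! ### Measurability of matrix operations -/

lemma Matrix.measurable_of_entries {Ω ι κ : Type*} [MeasurableSpace Ω] {B : Ω → Matrix ι κ ℝ}
    (h : ∀ i j, Measurable fun ω => B ω i j) : Measurable B :=
  measurable_pi_lambda _ fun i => measurable_pi_lambda _ fun j => h i j

lemma Measurable.matrix_entry {Ω ι κ : Type*} [MeasurableSpace Ω] {B : Ω → Matrix ι κ ℝ}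
    (h : Measurable B) (i : ι) (j : κ) : Measurable fun ω => B ω i j :=
  (measurable_pi_apply j).comp ((measurable_pi_apply i).comp h)

lemma Measurable.matrix_mulVec {Ω ι κ : Type*} [Fintype κ] [MeasurableSpace Ω]
    {B : Ω → Matrix ι κ ℝ} {v : Ω → κ → ℝ} (hB : Measurable B) (hv : Measurable v) :
    Measurable fun ω => B ω *ᵥ v ω :=
  measurable_pi_lambda _ fun i => Finset.measurable_sum _ fun j _ =>
    (hB.matrix_entry i j).mul ((measurable_pi_apply j).comp hv)

lemma Measurable.matrix_mul {Ω ι κ ι' : Type*} [Fintype κ] [MeasurableSpace Ω]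
    {B : Ω → Matrix ι κ ℝ} {C : Ω → Matrix κ ι' ℝ} (hB : Measurable B) (hC : Measurable C) :
    Measurable fun ω => B ω * C ω :=
  Matrix.measurable_of_entries fun i j => by
    simp only [mul_apply]
    exact Finset.measurable_sum _ fun l _ => (hB.matrix_entry i l).mul (hC.matrix_entry l j)

lemma Measurable.matrix_neg {Ω ι κ : Type*} [MeasurableSpace Ω]
    {B : Ω → Matrix ι κ ℝ} (hB : Measurable B) : Measurable fun ω => -B ω :=
  Matrix.measurable_of_entries fun i j => (hB.matrix_entry i j).neg

lemma Measurable.matrix_inv {Ω ι : Type*} [Fintype ι] [DecidableEq ι] [MeasurableSpace Ω]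
    {B : Ω → Matrix ι ι ℝ} (hB : Measurable B) : Measurable fun ω => (B ω)⁻¹ := by
  have hdet : ∀ {C : Ω → Matrix ι ι ℝ}, Measurable C → Measurable fun ω => (C ω).det := by
    intro C hC
    simp only [det_apply']
    exact Finset.measurable_sum _ fun σ _ => measurable_const.mul
      (Finset.measurable_prod _ fun i _ => hC.matrix_entry _ _)
  refine Matrix.measurable_of_entries fun i j => ?_
  simp only [inv_def, Matrix.smul_apply, smul_eq_mul, Ring.inverse_eq_inv', adjugate_apply]
  refine (hdet hB).inv.mul (hdet (Matrix.measurable_of_entries fun k l => ?_))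
  by_cases hk : k = j
  · subst hk
    simp
  · simpa [updateRow_ne hk] using hB.matrix_entry k l

/-! ### Affine images of conditionally standard normal vectors -/

/-- If `X = a + B Z` with `𝒢`-measurable `a`, `B` and `Z` standard normal given `𝒢`, then
`X | 𝒢 ∼ N(a, B B')`. -/
lemma IsStdNormalGiven.condGaussian {Ω κ ι : Type*} [Fintype κ] [Fintype ι] [DecidableEq ι]
    {𝒢 mΩ : MeasurableSpace Ω} {Q : Measure Ω} [IsFiniteMeasure Q] {Z : Ω → κ → ℝ}
    (h : IsStdNormalGiven 𝒢 Q Z) (h𝒢 : 𝒢 ≤ mΩ)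
    {X a : Ω → ι → ℝ} {B : Ω → Matrix ι κ ℝ} {S : Ω → Matrix ι ι ℝ} (ha : Measurable[𝒢] a)
    (hB : Measurable[𝒢] B) (hS : ∀ ω, S ω = B ω * (B ω)ᵀ) (hX : ∀ ω, X ω = a ω + B ω *ᵥ Z ω) :
    CondGaussian Q 𝒢 X a S := by
  obtain rfl : S = fun ω => B ω * (B ω)ᵀ := funext hS
  obtain rfl : X = fun ω => a ω + B ω *ᵥ Z ω := funext hX
  have haffine : ∀ (m : MeasurableSpace Ω), Measurable[m] a → Measurable[m] B →
      Measurable[m.prod inferInstance]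
        (fun q : Ω × (κ → ℝ) => WithLp.toLp 2 (a q.1 + B q.1 *ᵥ q.2)) :=
    fun m ha hB => (WithLp.measurable_toLp 2 _).comp ((ha.comp measurable_fst).add
      ((hB.comp measurable_fst).matrix_mulVec measurable_snd))
  refine ⟨ha, ?_, fun ω => ?_, fun E hE => ?_⟩
  · refine @Measurable.matrix_mul _ _ _ _ _ 𝒢 _ _ hB ?_
    exact @Matrix.measurable_of_entries _ _ _ 𝒢 _ fun i j =>
      @Measurable.matrix_entry _ _ _ 𝒢 _ hB j i
  · simpa [conjTranspose_eq_transpose_of_trivial] using posSemidef_self_mul_conjTranspose (B ω)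
  have hF := haffine 𝒢 ha hB
  have hX0 : Measurable fun ω => WithLp.toLp 2 (a ω + B ω *ᵥ Z ω) :=
    (haffine mΩ (ha.mono h𝒢 le_rfl) (hB.mono h𝒢 le_rfl)).comp (measurable_id.prodMk h.1)
  have hXE : MeasurableSet {ω | WithLp.toLp 2 (a ω + B ω *ᵥ Z ω) ∈ E} := hX0 hE
  have hFE : MeasurableSet[𝒢.prod inferInstance]
      {q : Ω × (κ → ℝ) | WithLp.toLp 2 (a q.1 + B q.1 *ᵥ q.2) ∈ E} := hF hE
  set γ : Measure (κ → ℝ) := Measure.pi fun _ : κ => gaussianReal 0 1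
  have hlaw : ∀ ω, (multivariateGaussian (WithLp.toLp 2 (a ω)) (B ω * (B ω)ᵀ)) E =
      γ {z | WithLp.toLp 2 (a ω + B ω *ᵥ z) ∈ E} := fun ω => by
    rw [← map_affine_pi_gaussianReal, Measure.map_apply _ hE]
    · rfl
    · exact (haffine mΩ (ha.mono h𝒢 le_rfl) (hB.mono h𝒢 le_rfl)).comp
        (measurable_const.prodMk measurable_id)
  have hgm : Measurable[𝒢] fun ω => γ {z | WithLp.toLp 2 (a ω + B ω *ᵥ z) ∈ E} :=
    @measurable_measure_prodMk_left _ _ 𝒢 _ γ _ _ hFE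
  have hgr : (fun ω => (multivariateGaussian (WithLp.toLp 2 (a ω)) (B ω * (B ω)ᵀ)).real E) =
      fun ω => (γ {z | WithLp.toLp 2 (a ω + B ω *ᵥ z) ∈ E}).toReal :=
    funext fun ω => congrArg ENNReal.toReal (hlaw ω)
  have hgrm : Measurable[𝒢] fun ω => (γ {z | WithLp.toLp 2 (a ω + B ω *ᵥ z) ∈ E}).toReal :=
    ENNReal.measurable_toReal.comp hgm
  rw [hgr]
  have hint : Integrable (fun ω => (γ {z | WithLp.toLp 2 (a ω + B ω *ᵥ z) ∈ E}).toReal) Q := by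
    refine Integrable.of_bound (C := 1) (hgrm.mono h𝒢 le_rfl).aestronglyMeasurable
      (ae_of_all _ fun ω => ?_)
    rw [Real.norm_of_nonneg ENNReal.toReal_nonneg]
    exact measureReal_le_one
  -- The candidate is `𝒢`-measurable, so only its integral over `A` in `𝒢` remains. It comes from
  -- integrating out `Z` in the indicator of "ω ∈ A and a + BZ ∈ E".
  refine (ae_eq_condExp_of_forall_setIntegral_eq h𝒢 ((integrable_const _).indicator hXE)
    (fun A _ _ => hint.integrableOn) (fun A hA _ => ?_)
    (hgrm.stronglyMeasurable.aestronglyMeasurable)).symm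
  have hA0 := h𝒢 _ hA
  have hind : ∀ (m : MeasurableSpace (Ω × (κ → ℝ))) (s : Set (Ω × (κ → ℝ))), MeasurableSet[m] s →
      Measurable[m] (s.indicator (1 : Ω × (κ → ℝ) → ENNReal)) :=
    fun m s hs => measurable_one.indicator hs
  have key := h.lintegral_eq h𝒢 (f := ((Prod.fst ⁻¹' A) ∩
    {q : Ω × (κ → ℝ) | WithLp.toLp 2 (a q.1 + B q.1 *ᵥ q.2) ∈ E}).indicator 1)
    (hind (𝒢.prod inferInstance) _ (MeasurableSet.inter ((@measurable_fst _ _ 𝒢 _) hA) hFE))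
  have hl : ∀ ω, (((Prod.fst ⁻¹' A) ∩
      {q : Ω × (κ → ℝ) | WithLp.toLp 2 (a q.1 + B q.1 *ᵥ q.2) ∈ E}).indicator 1 (ω, Z ω) :
        ENNReal) =
      (A ∩ {ω | WithLp.toLp 2 (a ω + B ω *ᵥ Z ω) ∈ E}).indicator 1 ω := fun ω => rfl
  have hr : ∀ ω, ∫⁻ z, (((Prod.fst ⁻¹' A) ∩
      {q : Ω × (κ → ℝ) | WithLp.toLp 2 (a q.1 + B q.1 *ᵥ q.2) ∈ E}).indicator 1 (ω, z) :
        ENNReal) ∂γ =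
      A.indicator (fun ω => γ {z | WithLp.toLp 2 (a ω + B ω *ᵥ z) ∈ E}) ω := fun ω => by
    by_cases hω : ω ∈ A
    · rw [Set.indicator_of_mem hω, ← lintegral_indicator_one]
      · congr 1
        ext z
        by_cases hz : WithLp.toLp 2 (a ω + B ω *ᵥ z) ∈ E
        · refine (Set.indicator_of_mem ?_ _).trans
            (Set.indicator_of_mem ?_ (1 : (κ → ℝ) → ENNReal)).symm
          exacts [⟨hω, hz⟩, hz]
        · refine (Set.indicator_of_notMem ?_ _).trans
            (Set.indicator_of_notMem ?_ (1 : (κ → ℝ) → ENNReal)).symm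
          exacts [fun hc => hz hc.2, hz]
      · exact @measurable_prodMk_left _ _ 𝒢 _ ω _ hFE
    · simp [Set.indicator, hω]
  simp_rw [hl] at key
  rw [lintegral_indicator_one (hA0.inter hXE)] at key
  rw [lintegral_congr hr, lintegral_indicator hA0] at key
  rw [integral_indicator_const _ hXE, smul_eq_mul, mul_one, measureReal_restrict_apply hXE,
    Set.inter_comm, measureReal_def, key, integral_toReal]
  · exact (hgm.mono h𝒢 le_rfl).aemeasurable
  · exact ae_of_all _ fun ω => measure_lt_top _ _

/-! ### The Cameron–Martin formula -/

/-- The exponential weight turns the standard normal density at x into its value at x - η, and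
Lebesgue measure is translation invariant. -/
lemma lintegral_exp_mul_indicator_gaussianReal (η : ℝ) {B : Set ℝ} (hB : MeasurableSet B) :
    ∫⁻ x, ENNReal.ofReal (Real.exp (η * x - 1 / 2 * (η * η))) * B.indicator 1 (x - η)
      ∂(gaussianReal 0 1) = gaussianReal 0 1 B := by
  have hm : Measurable fun x => ENNReal.ofReal (Real.exp (η * x - 1 / 2 * (η * η))) *
      B.indicator (1 : ℝ → ENNReal) (x - η) :=
    Measurable.mul (by fun_prop) ((measurable_one.indicator hB).comp (measurable_id.sub_const η))
  rw [gaussianReal_of_var_ne_zero 0 one_ne_zero,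
    lintegral_withDensity_eq_lintegral_mul _ (measurable_gaussianPDF 0 1) hm,
    withDensity_apply _ hB, ← lintegral_indicator hB,
    ← lintegral_sub_right_eq_self (μ := (volume : Measure ℝ)) (B.indicator _) η]
  refine lintegral_congr fun x => ?_
  rw [Pi.mul_apply, ← mul_assoc]
  have : gaussianPDF 0 1 x * ENNReal.ofReal (Real.exp (η * x - 1 / 2 * (η * η))) =
      gaussianPDF 0 1 (x - η) := by
    rw [gaussianPDF, gaussianPDF, ← ENNReal.ofReal_mul (gaussianPDFReal_nonneg _ _ _)]
    congr 1
    rw [gaussianPDFReal, gaussianPDFReal, mul_assoc, ← Real.exp_add]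
    congr 2
    simp
    ring
  rw [this]
  by_cases hx : x - η ∈ B <;> simp [hx]

lemma lintegral_prod_pi_gaussianReal {κ : Type*} [Fintype κ] {f : κ → ℝ → ENNReal}
    (hf : ∀ i, Measurable (f i)) :
    ∫⁻ z, ∏ i, f i (z i) ∂(Measure.pi fun _ : κ => gaussianReal 0 1) =
      ∏ i, ∫⁻ x, f i x ∂(gaussianReal 0 1) := by
  have hind : iIndepFun (fun i (z : κ → ℝ) => f i (z i))
      (Measure.pi fun _ : κ => gaussianReal 0 1) :=
    iIndepFun_pi (X := f) fun i => (hf i).aemeasurable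
  rw [lintegral_prod_eq_prod_lintegral_of_indepFun Finset.univ _ hind
    fun i => (hf i).comp (measurable_pi_apply i)]
  refine Finset.prod_congr rfl fun i _ => ?_
  rw [← (measurePreserving_eval (fun _ : κ => gaussianReal 0 1) i).lintegral_comp (hf i)]

/-- The Cameron–Martin formula for boxes. -/
lemma lintegral_exp_mul_indicator_pi_gaussianReal {κ : Type*} [Fintype κ] (η : κ → ℝ)
    {B : κ → Set ℝ} (hB : ∀ i, MeasurableSet (B i)) :
    ∫⁻ z, ENNReal.ofReal (Real.exp (η ⬝ᵥ z - 1 / 2 * (η ⬝ᵥ η))) *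
        ∏ i, (B i).indicator 1 ((z - η) i) ∂(Measure.pi fun _ : κ => gaussianReal 0 1) =
      ∏ i, gaussianReal 0 1 (B i) := by
  have e : ∀ z : κ → ℝ, ENNReal.ofReal (Real.exp (η ⬝ᵥ z - 1 / 2 * (η ⬝ᵥ η))) *
      ∏ i, (B i).indicator (1 : ℝ → ENNReal) ((z - η) i) =
      ∏ i, (ENNReal.ofReal (Real.exp (η i * z i - 1 / 2 * (η i * η i))) *
        (B i).indicator 1 (z i - η i)) := fun z => by
    rw [Finset.prod_mul_distrib, ← ENNReal.ofReal_prod_of_nonneg fun i _ => (Real.exp_pos _).le,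
      ← Real.exp_sum]
    simp [dotProduct, Finset.sum_sub_distrib, Finset.mul_sum]
  simp_rw [e]
  rw [lintegral_prod_pi_gaussianReal (f := fun i x =>
    ENNReal.ofReal (Real.exp (η i * x - 1 / 2 * (η i * η i))) * (B i).indicator 1 (x - η i))]
  · exact Finset.prod_congr rfl fun i _ => lintegral_exp_mul_indicator_gaussianReal (η i) (hB i)
  · exact fun i => Measurable.mul (by fun_prop)
      ((measurable_one.indicator (hB i)).comp (measurable_id.sub_const _))

/-- Girsanov's theorem for one step: shifting a conditionally standard normal vector. -/
lemma IsStdNormalGiven.lintegral_girsanov {Ω κ : Type*} [Fintype κ] {𝒢 mΩ : MeasurableSpace Ω}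
    {μ : Measure Ω} [IsFiniteMeasure μ] {Z : Ω → κ → ℝ} (h : IsStdNormalGiven 𝒢 μ Z)
    (h𝒢 : 𝒢 ≤ mΩ) {η : Ω → κ → ℝ} (hη : Measurable[𝒢] η) {g : Ω → ENNReal}
    (hg : Measurable[𝒢] g) {B : κ → Set ℝ} (hB : ∀ i, MeasurableSet (B i)) :
    ∫⁻ ω, g ω * (ENNReal.ofReal (Real.exp (η ω ⬝ᵥ Z ω - 1 / 2 * (η ω ⬝ᵥ η ω))) *
        ∏ i, (B i).indicator 1 ((Z ω - η ω) i)) ∂μ =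
      (∫⁻ ω, g ω ∂μ) * ∏ i, gaussianReal 0 1 (B i) := by
  have hmeas : ∀ (m : MeasurableSpace Ω), Measurable[m] η → Measurable[m] g →
      Measurable[m.prod inferInstance] fun q : Ω × (κ → ℝ) =>
        g q.1 * (ENNReal.ofReal (Real.exp (η q.1 ⬝ᵥ q.2 - 1 / 2 * (η q.1 ⬝ᵥ η q.1))) *
          ∏ i, (B i).indicator 1 ((q.2 - η q.1) i)) := by
    intro m hη hg
    have h1 : ∀ i, Measurable fun q : Ω × (κ → ℝ) => η q.1 i := fun i =>
      (measurable_pi_apply i).comp (hη.comp measurable_fst)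
    have h2 : ∀ i, Measurable fun q : Ω × (κ → ℝ) => q.2 i := fun i =>
      (measurable_pi_apply i).comp measurable_snd
    refine (hg.comp measurable_fst).mul (Measurable.mul ?_ ?_)
    · refine (Real.measurable_exp.comp (Measurable.sub ?_ (Measurable.const_mul ?_ _))).ennreal_ofReal
      · exact Finset.measurable_sum _ fun i _ => (h1 i).mul (h2 i)
      · exact Finset.measurable_sum _ fun i _ => (h1 i).mul (h1 i)
    · exact Finset.measurable_prod _ fun i _ =>
        (measurable_one.indicator (hB i)).comp ((h2 i).sub (h1 i))
  rw [h.lintegral_eq h𝒢 (hmeas 𝒢 hη hg)]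
  have : ∀ ω, ∫⁻ z, g ω * (ENNReal.ofReal (Real.exp (η ω ⬝ᵥ z - 1 / 2 * (η ω ⬝ᵥ η ω))) *
        ∏ i, (B i).indicator 1 ((z - η ω) i)) ∂(Measure.pi fun _ : κ => gaussianReal 0 1) =
      g ω * ∏ i, gaussianReal 0 1 (B i) := fun ω => by
    rw [lintegral_const_mul, lintegral_exp_mul_indicator_pi_gaussianReal _ hB]
    refine Measurable.mul ?_ ?_
    · refine (Real.measurable_exp.comp (Measurable.sub_const ?_ _)).ennreal_ofReal
      exact Finset.measurable_sum _ fun i _ => (measurable_pi_apply i).const_mul _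
    · exact Finset.measurable_prod _ fun i _ =>
        (measurable_one.indicator (hB i)).comp ((measurable_pi_apply i).sub_const _)
  simp_rw [this]
  rw [lintegral_mul_const _ (hg.mono h𝒢 le_rfl)]

/-! ### The Cholesky factor -/

/-- The Cholesky factor is a measurable function of the matrix. -/
lemma measurable_choleskyFactor {Ω : Type*} [MeasurableSpace Ω] {n : ℕ}
    {L S : Ω → Matrix (Fin n) (Fin n) ℝ} (hS : Measurable S)
    (h : ∀ ω, IsCholeskyFactor (L ω) (S ω)) : Measurable L := by
  -- Terms with `l > j` vanish because `L j l = 0`, so column `j` is determined by `S`, the earlier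
  -- columns and the pivot `L j j`. The pivot is a square root because it is positive, and dividing
  -- by it gives the other entries. Induction on the column concludes.
  have hsplit : ∀ ω i j, j ≤ i → S ω i j =
      (∑ l ∈ Finset.univ.filter (· < j), L ω i l * L ω j l) + L ω i j * L ω j j := by
    intro ω i j _
    rw [← (h ω).2.2, mul_apply, ← Finset.sum_filter_add_sum_filter_not Finset.univ (· < j)]
    congr 1
    simp only [transpose_apply]
    refine Finset.sum_eq_single j (fun l hl hlj => ?_) (fun hj => ?_)
    · have : j < l := lt_of_le_of_ne (by simpa using hl) hlj.symm
      rw [(h ω).1 j l this, mul_zero]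
    · simp at hj
  have key : ∀ j i, Measurable fun ω => L ω i j := by
    intro j
    induction j using WellFoundedLT.induction with
    | ind j ih =>
      have hsum : ∀ i, Measurable fun ω =>
          ∑ l ∈ Finset.univ.filter (· < j), L ω i l * L ω j l := fun i =>
        Finset.measurable_sum _ fun l hl =>
          (ih l (by simpa using hl) i).mul (ih l (by simpa using hl) j)
      have hjj : Measurable fun ω => L ω j j := by
        have : (fun ω => L ω j j) = fun ω =>
            Real.sqrt (S ω j j - ∑ l ∈ Finset.univ.filter (· < j), L ω j l * L ω j l) := by
          ext ω
          rw [hsplit ω j j le_rfl, add_sub_cancel_left, Real.sqrt_mul_self ((h ω).2.1 j).le]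
        rw [this]
        exact ((hS.matrix_entry j j).sub (hsum j)).sqrt
      intro i
      rcases lt_or_ge i j with hij | hij
      · simp only [(h _).1 i j hij]
        exact measurable_const
      · have : (fun ω => L ω i j) = fun ω =>
            (S ω i j - ∑ l ∈ Finset.univ.filter (· < j), L ω i l * L ω j l) / L ω j j := by
          ext ω
          rw [hsplit ω i j hij, add_sub_cancel_left, mul_div_cancel_right₀ _ ((h ω).2.1 j).ne']
        rw [this]
        exact ((hS.matrix_entry i j).sub (hsum i)).div hjj
  exact Matrix.measurable_of_entries fun i j => key j i

lemma IsCholeskyFactor.isUnit_det {n : ℕ} {L S : Matrix (Fin n) (Fin n) ℝ}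
    (h : IsCholeskyFactor L S) : IsUnit L.det := by
  rw [det_of_isLowerTriangular L (fun i j hij => h.1 i j hij)]
  exact (Finset.prod_pos fun i _ => h.2.1 i).ne'.isUnit

/-! ### The information σ-fields -/

namespace MSVAR

variable {Ω : Type*} {n k p T N n' k' p' q' Tpast : ℕ}
  (M : MSVAR Ω n k p T N n' k' p' q' Tpast)

lemma F0_le_H (t : ℤ) : M.F0 ≤ M.H t :=
  le_sup_of_le_left (le_sup_of_le_left (le_sup_of_le_left le_sup_left))

lemma sigmaCoeff_le_H (t : ℤ) : M.sigmaCoeff ≤ M.H t :=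
  le_sup_of_le_left (le_sup_of_le_left le_sup_right)

lemma sigmaTrans_le_H (t : ℤ) : M.sigmaTrans ≤ M.H t := le_sup_of_le_left le_sup_right

lemma sigmaRegimes_le_H (t : ℤ) : M.sigmaRegimes T ≤ M.H t := le_sup_right

lemma H_mono {t t' : ℤ} (h : t ≤ t') : M.H t ≤ M.H t' := by
  refine sup_le_sup_right (sup_le_sup_right (sup_le_sup_right (sup_le_sup_left ?_ _) _) _) _
  exact biSup_mono fun u hu => Finset.Icc_subset_Icc_right h hu

lemma comap_y_le_H {t u : ℤ} (h : u ∈ Finset.Icc 1 t) :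
    MeasurableSpace.comap (M.y u) inferInstance ≤ M.H t :=
  le_sup_of_le_left (le_sup_of_le_left (le_sup_of_le_left (le_sup_of_le_right
    (le_iSup₂_of_le u h le_rfl))))

lemma measurable_y_H {t u : ℤ} (h₁ : 1 - (p : ℤ) ≤ u) (h₂ : u ≤ t) :
    Measurable[M.H t] (M.y u) := by
  rw [measurable_iff_comap_le]
  rcases le_or_gt u 0 with h | h
  · refine le_trans ?_ (M.F0_le_H t)
    exact le_sup_of_le_left (le_sup_of_le_left
      (le_iSup₂_of_le u (Finset.mem_Icc.2 ⟨by omega, h⟩) le_rfl))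
  · exact M.comap_y_le_H (Finset.mem_Icc.2 ⟨h, h₂⟩)

lemma measurable_psi_H (t : ℤ) {u : ℤ} (hu : u ∈ Finset.Icc (1 : ℤ) T) :
    Measurable[M.H t] (M.psi u) := by
  rw [measurable_iff_comap_le]
  refine le_trans ?_ (M.F0_le_H t)
  rw [Finset.mem_Icc] at hu
  exact le_sup_of_le_left (le_sup_of_le_right
    (le_iSup₂_of_le u (Finset.mem_Icc.2 ⟨by omega, hu.2⟩) le_rfl))

lemma measurable_s_sigmaRegimes {u : ℤ} (hu : u ∈ Finset.Icc (1 : ℤ) T) :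
    Measurable[M.sigmaRegimes T] (M.s u) := by
  rw [measurable_iff_comap_le]
  exact le_iSup₂_of_le u hu le_rfl

lemma measurable_apply_fin {N : ℕ} {β : Type*} [MeasurableSpace Ω] [MeasurableSpace β]
    {f : Fin N → Ω → β} {s : Ω → Fin N} (hf : ∀ j, Measurable (f j)) (hs : Measurable s) :
    Measurable fun ω => f (s ω) ω :=
  (measurable_from_prod_countable_right (f := fun q : Fin N × Ω => f q.1 q.2) hf).comp
    (hs.prodMk measurable_id)

lemma measurable_Pi_sigmaCoeff (j : Fin N) : Measurable[M.sigmaCoeff] (M.Pi j) := by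
  rw [measurable_iff_comap_le]
  exact le_sup_of_le_left (le_iSup_of_le j le_rfl)

lemma measurable_Gam_sigmaCoeff (j : Fin N) : Measurable[M.sigmaCoeff] (M.Gam j) := by
  rw [measurable_iff_comap_le]
  exact le_sup_of_le_right (le_iSup_of_le j le_rfl)

lemma measurable_PiAt_H (t : ℤ) {u : ℤ} (hu : u ∈ Finset.Icc (1 : ℤ) T) :
    Measurable[M.H t] (M.PiAt u) :=
  @measurable_apply_fin _ _ _ (M.H t) _ _ _
    (fun j => (M.measurable_Pi_sigmaCoeff j).mono (M.sigmaCoeff_le_H t) le_rfl)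
    ((M.measurable_s_sigmaRegimes hu).mono (M.sigmaRegimes_le_H t) le_rfl)

lemma measurable_GamAt_H (t : ℤ) {u : ℤ} (hu : u ∈ Finset.Icc (1 : ℤ) T) :
    Measurable[M.H t] (M.GamAt u) :=
  @measurable_apply_fin _ _ _ (M.H t) _ _ _
    (fun j => (M.measurable_Gam_sigmaCoeff j).mono (M.sigmaCoeff_le_H t) le_rfl)
    ((M.measurable_s_sigmaRegimes hu).mono (M.sigmaRegimes_le_H t) le_rfl)

lemma IBefore_le_H {t : ℤ} (ht : t ∈ Finset.Icc (1 : ℤ) T) : M.IBefore t ≤ M.H (t - 1) := by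
  rw [Finset.mem_Icc] at ht
  have hsub : ∀ u ∈ Finset.Icc (1 : ℤ) t, u ∈ Finset.Icc (1 : ℤ) T := fun u hu =>
    Finset.Icc_subset_Icc_right ht.2 hu
  refine sup_le (sup_le (sup_le (sup_le ?_ ?_) ?_) ?_) ?_
  · exact le_sup_of_le_left (le_sup_of_le_left le_sup_left)
  · exact iSup₂_le fun u hu => (M.measurable_PiAt_H _ (hsub u hu)).comap_le
  · exact iSup₂_le fun u hu => (M.measurable_GamAt_H _ (hsub u hu)).comap_le
  · exact M.sigmaTrans_le_H _
  · exact le_trans (biSup_mono hsub) (M.sigmaRegimes_le_H _)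

lemma measurable_lagged_H {t : ℤ} (ht : t ∈ Finset.Icc (1 : ℤ) T) :
    Measurable[M.H (t - 1)] (M.lagged t) := by
  refine @measurable_pi_lambda _ _ _ (M.H (t - 1)) _ _ fun c => ?_
  rcases c with c | ⟨l, i⟩
  · exact (measurable_pi_apply c).comp (M.measurable_psi_H (t - 1) ht)
  · rw [Finset.mem_Icc] at ht
    have := l.2
    exact (measurable_pi_apply i).comp (M.measurable_y_H (by omega) (by omega))

lemma H_le_H_pred_sup (t : ℤ) :
    M.H t ≤ M.H (t - 1) ⊔ MeasurableSpace.comap (M.y t) inferInstance := by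
  refine sup_le (sup_le (sup_le (sup_le ?_ (iSup₂_le fun u hu => ?_)) ?_) ?_) ?_
  · exact le_sup_of_le_left (M.F0_le_H _)
  · rw [Finset.mem_Icc] at hu
    rcases hu.2.eq_or_lt with rfl | h
    · exact le_sup_right
    · exact le_sup_of_le_left (M.comap_y_le_H (Finset.mem_Icc.2 ⟨hu.1, by omega⟩))
  · exact le_sup_of_le_left (M.sigmaCoeff_le_H _)
  · exact le_sup_of_le_left (M.sigmaTrans_le_H _)
  · exact le_sup_of_le_left (M.sigmaRegimes_le_H _)

lemma H_zero_le : M.H 0 ≤ M.F0 ⊔ (M.sigmaCoeff ⊔ M.sigmaTrans ⊔ M.sigmaRegimes T) := by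
  refine sup_le (sup_le (sup_le (sup_le le_sup_left (iSup₂_le fun u hu => ?_)) ?_) ?_) ?_
  · rw [Finset.mem_Icc] at hu
    omega
  · exact le_sup_of_le_right (le_sup_of_le_left le_sup_left)
  · exact le_sup_of_le_right (le_sup_of_le_left le_sup_right)
  · exact le_sup_of_le_right le_sup_right

lemma measurable_mean_H {t : ℤ} (ht : t ∈ Finset.Icc (1 : ℤ) T) :
    Measurable[M.H (t - 1)] fun ω => M.PiAt t ω *ᵥ M.lagged t ω :=
  @Measurable.matrix_mulVec _ _ _ _ (M.H (t - 1)) _ _ (M.measurable_PiAt_H _ ht)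
    (M.measurable_lagged_H ht)

lemma IsModel.measurable_chol {M : MSVAR Ω n k p T N n' k' p' q' Tpast} {𝒢 : MeasurableSpace Ω}
    [MeasurableSpace Ω] {μ : Measure Ω} (hM : M.IsModel μ) {t : ℤ}
    (ht : t ∈ Finset.Icc (1 : ℤ) T) (h : Measurable[𝒢] (M.Sig t)) : Measurable[𝒢] (M.chol t) :=
  @measurable_choleskyFactor _ 𝒢 _ _ _ h (hM.cholesky t ht)

/-- In the model equation everything but ε_t is known at time t - 1, so adding the noise to the past
is enough to know y_t. -/
lemma IsModel.measurable_y_of_eps {M : MSVAR Ω n k p T N n' k' p' q' Tpast}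
    {𝒢 : MeasurableSpace Ω} [MeasurableSpace Ω] {μ : Measure Ω} (hM : M.IsModel μ) {t : ℤ}
    (ht : t ∈ Finset.Icc (1 : ℤ) T) (hle : M.H (t - 1) ≤ 𝒢) (h : Measurable[𝒢] (M.eps t)) :
    Measurable[𝒢] (M.y t) := by
  have e : M.y t = fun ω => M.PiAt t ω *ᵥ M.lagged t ω + M.chol t ω *ᵥ M.eps t ω :=
    funext fun ω => hM.equation _ ht ω
  have hSig := (hM.predictable t ht).mono ((M.IBefore_le_H ht).trans hle) le_rfl
  rw [e]
  exact ((M.measurable_mean_H ht).mono hle le_rfl).add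
    (@Measurable.matrix_mulVec _ _ _ _ 𝒢 _ _ (hM.measurable_chol ht hSig) h)

/-! ### The noise and the density factors under the real-world measure -/

/-- The standardized Girsanov kernel `η_t = Σ_t^{-1/2} θ_t`. -/
noncomputable def eta (θ : ℤ → Ω → Fin n → ℝ) (t : ℤ) (ω : Ω) : Fin n → ℝ :=
  (M.chol t ω)⁻¹ *ᵥ θ t ω

/-- The white noise `ε_t - η_t` of the risk-neutral measure. -/
noncomputable def epsTilde (θ : ℤ → Ω → Fin n → ℝ) (t : ℤ) (ω : Ω) : Fin n → ℝ :=
  M.eps t ω - M.eta θ t ω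

/-- The factor of the state price density at time `t`. -/
noncomputable def densityFactor (θ : ℤ → Ω → Fin n → ℝ) (t : ℤ) (ω : Ω) : ℝ :=
  Real.exp (θ t ω ⬝ᵥ ((M.Sig t ω)⁻¹ *ᵥ M.xi t ω) - 1 / 2 * (θ t ω ⬝ᵥ ((M.Sig t ω)⁻¹ *ᵥ θ t ω)))

variable {M} [mΩ : MeasurableSpace Ω] {μ : Measure Ω}
  {θ : ℤ → Ω → Fin n → ℝ} {Δ : ℤ → Ω → Matrix (Fin n) (Cols k p n) ℝ}

namespace IsModel

lemma F0_le (hM : M.IsModel μ) : M.F0 ≤ mΩ :=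
  sup_le (sup_le (iSup₂_le fun u _ => (hM.measurable_y u).comap_le)
    (iSup₂_le fun u _ => (hM.measurable_psi u).comap_le))
    (iSup₂_le fun u _ => (hM.measurable_Sig u).comap_le)

lemma sigmaCoeff_le (hM : M.IsModel μ) : M.sigmaCoeff ≤ mΩ :=
  sup_le (iSup_le fun j => (hM.measurable_Pi j).comap_le)
    (iSup_le fun j => (hM.measurable_Gam j).comap_le)

lemma sigmaRegimes_le (hM : M.IsModel μ) (t : ℤ) : M.sigmaRegimes t ≤ mΩ :=
  iSup₂_le fun u _ => (hM.measurable_s u).comap_le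

lemma sigmaTrans_le (hM : M.IsModel μ) : M.sigmaTrans ≤ mΩ := hM.measurable_trans.comap_le

lemma sigmaNoise_le (hM : M.IsModel μ) : M.sigmaNoise ≤ mΩ :=
  iSup₂_le fun u _ => (hM.measurable_eps u).comap_le

lemma H_le (hM : M.IsModel μ) (t : ℤ) : M.H t ≤ mΩ :=
  sup_le (sup_le (sup_le (sup_le hM.F0_le (iSup₂_le fun u _ => (hM.measurable_y u).comap_le))
    hM.sigmaCoeff_le) hM.sigmaTrans_le) (hM.sigmaRegimes_le T)

lemma measurable_Sig_H (hM : M.IsModel μ) {t : ℤ} (ht : t ∈ Finset.Icc (1 : ℤ) T) :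
    Measurable[M.H (t - 1)] (M.Sig t) :=
  (hM.predictable t ht).mono (M.IBefore_le_H ht) le_rfl

lemma measurable_chol_H (hM : M.IsModel μ) {t : ℤ} (ht : t ∈ Finset.Icc (1 : ℤ) T) :
    Measurable[M.H (t - 1)] (M.chol t) :=
  hM.measurable_chol ht (hM.measurable_Sig_H ht)

lemma isUnit_det_chol (hM : M.IsModel μ) {t : ℤ} (ht : t ∈ Finset.Icc (1 : ℤ) T) (ω : Ω) :
    IsUnit (M.chol t ω).det :=
  (hM.cholesky t ht ω).isUnit_det

/-- The Cholesky factor is invertible, so the model equation can be solved for ε_t in terms of y_t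
and quantities known at time t - 1. -/
lemma measurable_eps_H (hM : M.IsModel μ) {t : ℤ} (ht : t ∈ Finset.Icc (1 : ℤ) T) :
    Measurable[M.H t] (M.eps t) := by
  have hle := M.H_mono (sub_le_self t zero_le_one)
  have ht' := Finset.mem_Icc.1 ht
  have e : M.eps t = fun ω => (M.chol t ω)⁻¹ *ᵥ (M.y t ω - M.PiAt t ω *ᵥ M.lagged t ω) := by
    ext1 ω
    rw [hM.equation t ht ω, add_sub_cancel_left, xi, mulVec_mulVec,
      nonsing_inv_mul _ (hM.isUnit_det_chol ht ω), one_mulVec]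
  rw [e]
  exact @Measurable.matrix_mulVec _ _ _ _ (M.H t) _ _
    (@Measurable.matrix_inv _ _ _ _ (M.H t) _ ((hM.measurable_chol_H ht).mono hle le_rfl))
    ((M.measurable_y_H (by omega) le_rfl).sub ((M.measurable_mean_H ht).mono hle le_rfl))

lemma measurable_eta_H (hM : M.IsModel μ) (hθ : M.IsLinearKernel θ Δ) {t : ℤ}
    (ht : t ∈ Finset.Icc (1 : ℤ) T) : Measurable[M.H (t - 1)] (M.eta θ t) :=
  @Measurable.matrix_mulVec _ _ _ _ (M.H (t - 1)) _ _
    (@Measurable.matrix_inv _ _ _ _ (M.H (t - 1)) _ (hM.measurable_chol_H ht))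
    ((hθ t ht).1.mono (M.IBefore_le_H ht) le_rfl)

lemma measurable_epsTilde_H (hM : M.IsModel μ) (hθ : M.IsLinearKernel θ Δ) {t : ℤ}
    (ht : t ∈ Finset.Icc (1 : ℤ) T) : Measurable[M.H t] (M.epsTilde θ t) :=
  (hM.measurable_eps_H ht).sub
    ((hM.measurable_eta_H hθ ht).mono (M.H_mono (sub_le_self t zero_le_one)) le_rfl)

/-- Information at time `t` is generated by initial information and the noise up to time `t`. -/
lemma H_le_noise (hM : M.IsModel μ) (t : ℕ) (ht : t ≤ T) :
    M.H t ≤ (⨆ u ∈ Finset.Icc (1 : ℤ) t, MeasurableSpace.comap (M.eps u) inferInstance) ⊔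
      M.H 0 := by
  induction t with
  | zero => exact le_sup_right
  | succ t ih =>
    have hmem : ((t : ℤ) + 1) ∈ Finset.Icc (1 : ℤ) T := Finset.mem_Icc.2 ⟨by omega, by omega⟩
    push_cast
    have h1 : M.H t ≤ (⨆ u ∈ Finset.Icc (1 : ℤ) (t + 1),
        MeasurableSpace.comap (M.eps u) inferInstance) ⊔ M.H 0 :=
      (ih (by omega)).trans (sup_le_sup_right
        (biSup_mono fun u hu => Finset.Icc_subset_Icc_right (by omega) hu) _)
    refine (M.H_le_H_pred_sup _).trans ?_
    rw [add_sub_cancel_right]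
    refine sup_le h1 (Measurable.comap_le ?_)
    refine hM.measurable_y_of_eps hmem (by rwa [add_sub_cancel_right]) ?_
    rw [measurable_iff_comap_le]
    exact le_sup_of_le_left (le_iSup₂_of_le ((t : ℤ) + 1)
      (Finset.mem_Icc.2 ⟨by omega, le_rfl⟩) le_rfl)

/-- The whole noise is independent of 𝓗_0 and ε_t is independent of the past noise; regrouping, ε_t
is independent of their join, which contains 𝓗_{t-1}. -/
lemma isStdNormalGiven_eps [IsProbabilityMeasure μ] (hM : M.IsModel μ) {t : ℤ}
    (ht : t ∈ Finset.Icc (1 : ℤ) T) : IsStdNormalGiven (M.H (t - 1)) μ (M.eps t) := by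
  refine isStdNormalGiven_of_indep (hM.measurable_eps t)
    (HasLaw.map_eq_pi_gaussianReal (hM.measurable_eps t) (hM.noise_law t ht)) ?_
  have ht' := Finset.mem_Icc.1 ht
  have hpast : (⨆ u ∈ Finset.Icc (1 : ℤ) (t - 1), MeasurableSpace.comap (M.eps u) inferInstance) ≤
      M.sigmaNoise := biSup_mono fun u hu => Finset.Icc_subset_Icc_right (by omega) hu
  have hcur : MeasurableSpace.comap (M.eps t) inferInstance ≤ M.sigmaNoise :=
    le_iSup₂_of_le t ht le_rfl
  have h0 : Indep M.sigmaNoise (M.H 0) μ :=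
    indep_of_indep_of_le_right (hM.noise_condIndep.indep_sup hM.F0_le hM.sigmaNoise_le
      (sup_le (sup_le hM.sigmaCoeff_le hM.sigmaTrans_le) (hM.sigmaRegimes_le T))
      hM.noise_indep_init) M.H_zero_le
  have h12 : Indep (MeasurableSpace.comap (M.eps t) inferInstance)
      (⨆ u ∈ Finset.Icc (1 : ℤ) (t - 1), MeasurableSpace.comap (M.eps u) inferInstance) μ := by
    have hd := indep_iSup_of_disjoint (fun u : Times 1 T => (hM.measurable_eps u).comap_le)
      hM.noise_indep.iIndep (S := {⟨t, ht⟩}) (T := {⟨t, ht⟩}ᶜ) disjoint_compl_right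
    refine indep_of_indep_of_le_left (indep_of_indep_of_le_right hd ?_) ?_
    · refine iSup₂_le fun u hu => ?_
      rw [Finset.mem_Icc] at hu
      have hmem : (⟨u, Finset.mem_Icc.2 ⟨hu.1, by omega⟩⟩ : Times 1 T) ∈
          ({⟨t, ht⟩}ᶜ : Set (Times 1 T)) := by
        simp only [Set.mem_compl_iff, Set.mem_singleton_iff, Subtype.mk.injEq]
        omega
      exact le_biSup (fun u : Times 1 T => MeasurableSpace.comap (M.eps u) inferInstance) hmem
    · exact le_biSup (fun u : Times 1 T => MeasurableSpace.comap (M.eps u) inferInstance)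
        (Set.mem_singleton (⟨t, ht⟩ : Times 1 T))
  have hK := Indep.sup_right_of_sup_left (hcur.trans hM.sigmaNoise_le)
    (hpast.trans hM.sigmaNoise_le) (hM.H_le 0) h12
    (indep_of_indep_of_le_left h0 (sup_le hcur hpast))
  refine indep_of_indep_of_le_right hK ?_
  obtain ⟨d, hd⟩ : ∃ d : ℕ, t - 1 = d := ⟨(t - 1).toNat, by omega⟩
  rw [hd]
  exact hM.H_le_noise d (by omega)

/-- With Σ = LL' one has θ'Σ⁻¹(Lv) = (L⁻¹θ)'v for every v. Take v = ε for the linear term and v = η,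
where Lη = θ, for the quadratic one. -/
lemma densityFactor_eq (hM : M.IsModel μ) (θ : ℤ → Ω → Fin n → ℝ) {t : ℤ}
    (ht : t ∈ Finset.Icc (1 : ℤ) T) (ω : Ω) :
    M.densityFactor θ t ω =
      Real.exp (M.eta θ t ω ⬝ᵥ M.eps t ω - 1 / 2 * (M.eta θ t ω ⬝ᵥ M.eta θ t ω)) := by
  have hL := hM.isUnit_det_chol ht ω
  have key : ∀ v, θ t ω ⬝ᵥ ((M.Sig t ω)⁻¹ *ᵥ (M.chol t ω *ᵥ v)) = M.eta θ t ω ⬝ᵥ v := by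
    intro v
    rw [← (hM.cholesky t ht ω).2.2, Matrix.mul_inv_rev, mulVec_mulVec, Matrix.mul_assoc,
      nonsing_inv_mul _ hL, Matrix.mul_one, ← transpose_nonsing_inv, dotProduct_mulVec,
      vecMul_transpose, eta]
  have hθ : θ t ω = M.chol t ω *ᵥ M.eta θ t ω := by
    rw [eta, mulVec_mulVec, mul_nonsing_inv _ hL, one_mulVec]
  rw [densityFactor, xi, key]
  congr 3
  nth_rewrite 2 [hθ]
  exact key _

lemma measurable_densityFactor_H (hM : M.IsModel μ) (hθ : M.IsLinearKernel θ Δ) {t : ℤ}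
    (ht : t ∈ Finset.Icc (1 : ℤ) T) : Measurable[M.H t] (M.densityFactor θ t) := by
  have h1 := (hM.measurable_eta_H hθ ht).mono (M.H_mono (sub_le_self t zero_le_one)) le_rfl
  have h2 := hM.measurable_eps_H ht
  have hdot : ∀ {v w : Ω → Fin n → ℝ}, Measurable[M.H t] v → Measurable[M.H t] w →
      Measurable[M.H t] fun ω => v ω ⬝ᵥ w ω := fun hv hw =>
    Finset.measurable_sum _ fun i _ =>
      ((measurable_pi_apply i).comp hv).mul ((measurable_pi_apply i).comp hw)
  rw [funext (hM.densityFactor_eq θ ht)]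
  exact Real.measurable_exp.comp ((hdot h1 h2).sub ((hdot h1 h1).const_mul _))

end IsModel

end MSVAR

/-! ### The risk-neutral measure and its shifted noise -/

lemma Int.Icc_succ_right_eq_insert {a b : ℤ} (h : a ≤ b + 1) :
    Finset.Icc a (b + 1) = insert (b + 1) (Finset.Icc a b) := by
  ext x
  simp only [Finset.mem_Icc, Finset.mem_insert]
  omega

namespace MSVAR

variable {Ω : Type*} {n k p T N n' k' p' q' Tpast : ℕ}
  {M : MSVAR Ω n k p T N n' k' p' q' Tpast} {θ : ℤ → Ω → Fin n → ℝ} {Δ : ℤ → Ω → Matrix (Fin n) (Cols k p n) ℝ}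

lemma stateDensity_eq_mul {t : ℤ} (ht : t ∈ Finset.Icc (0 : ℤ) T) (ω : Ω) :
    M.stateDensity θ T ω =
      M.stateDensity θ t ω * ∏ m ∈ Finset.Icc (t + 1) (T : ℤ), M.densityFactor θ m ω := by
  rw [Finset.mem_Icc] at ht
  have : Finset.Icc (1 : ℤ) T = Finset.Icc 1 t ∪ Finset.Icc (t + 1) T := by
    ext x
    simp only [Finset.mem_Icc, Finset.mem_union]
    omega
  rw [stateDensity, this, Finset.prod_union]
  · rfl
  · rw [Finset.disjoint_left]
    intro x
    simp only [Finset.mem_Icc]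
    omega

variable [mΩ : MeasurableSpace Ω] {μ : Measure Ω}

namespace IsModel

lemma measurable_boxFactor_H (hM : M.IsModel μ) (hθ : M.IsLinearKernel θ Δ) {t : ℤ}
    (ht : t ∈ Finset.Icc (1 : ℤ) T) {B : Fin n → Set ℝ} (hB : ∀ i, MeasurableSet (B i)) :
    Measurable[M.H t] fun ω => ENNReal.ofReal (M.densityFactor θ t ω) *
      ∏ i, (B i).indicator (1 : ℝ → ENNReal) (M.epsTilde θ t ω i) :=
  (ENNReal.measurable_ofReal.comp (hM.measurable_densityFactor_H hθ ht)).mul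
    (Finset.measurable_prod _ fun i _ => (measurable_one.indicator (hB i)).comp
      ((measurable_pi_apply i).comp (hM.measurable_epsTilde_H hθ ht)))

/-- Girsanov's theorem for the steps `t + 1, …, t + d`. -/
lemma lintegral_girsanov [IsProbabilityMeasure μ] (hM : M.IsModel μ) (hθ : M.IsLinearKernel θ Δ)
    {t : ℤ} (ht : 0 ≤ t) {g : Ω → ENNReal} (hg : Measurable[M.H t] g) {B : ℤ → Fin n → Set ℝ}
    (hB : ∀ m i, MeasurableSet (B m i)) (d : ℕ) (hd : t + d ≤ T) :
    ∫⁻ ω, g ω * ∏ m ∈ Finset.Icc (t + 1) (t + d), (ENNReal.ofReal (M.densityFactor θ m ω) *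
        ∏ i, (B m i).indicator 1 (M.epsTilde θ m ω i)) ∂μ =
      (∫⁻ ω, g ω ∂μ) * ∏ m ∈ Finset.Icc (t + 1) (t + d), ∏ i, gaussianReal 0 1 (B m i) := by
  induction d with
  | zero => simp
  | succ d ih =>
    have hmem : t + d + 1 ∈ Finset.Icc (1 : ℤ) T :=
      Finset.mem_Icc.2 ⟨by omega, by push_cast at hd; omega⟩
    have hnot : t + d + 1 ∉ Finset.Icc (t + 1) (t + d) := by simp
    have hIcc : Finset.Icc (t + 1) (t + (d + 1 : ℕ)) =
        insert (t + d + 1) (Finset.Icc (t + 1) (t + d)) := by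
      rw [← Int.Icc_succ_right_eq_insert (by omega)]
      push_cast
      rw [add_assoc]
    have hstd := hM.isStdNormalGiven_eps hmem
    have hη := hM.measurable_eta_H hθ hmem
    rw [add_sub_cancel_right] at hstd hη
    -- All factors up to time t + d are known at that time, so together with `g` they form the
    -- weight in the one-step formula at time t + d + 1.
    have hg' : Measurable[M.H (t + d)] fun ω => g ω * ∏ m ∈ Finset.Icc (t + 1) (t + d),
        (ENNReal.ofReal (M.densityFactor θ m ω) *
          ∏ i, (B m i).indicator (1 : ℝ → ENNReal) (M.epsTilde θ m ω i)) := by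
      refine (hg.mono (M.H_mono (by omega)) le_rfl).mul (Finset.measurable_prod _ fun m hm => ?_)
      rw [Finset.mem_Icc] at hm
      rw [Finset.mem_Icc] at hmem
      exact (hM.measurable_boxFactor_H hθ (Finset.mem_Icc.2 ⟨by omega, by omega⟩) (hB m)).mono
        (M.H_mono hm.2) le_rfl
    have key := hstd.lintegral_girsanov (hM.H_le _) hη hg' (hB (t + d + 1))
    rw [ih (by push_cast at hd; omega)] at key
    rw [hIcc, Finset.prod_insert hnot, mul_comm (∏ i, _), ← mul_assoc, ← key]
    refine lintegral_congr fun ω => ?_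
    rw [Finset.prod_insert hnot, hM.densityFactor_eq θ hmem, mul_comm (_ * ∏ i, _), ← mul_assoc]
    rfl

lemma measurable_stateDensity_H (hM : M.IsModel μ) (hθ : M.IsLinearKernel θ Δ) {t : ℤ}
    (ht : t ≤ T) : Measurable[M.H t] (M.stateDensity θ t) := by
  refine Finset.measurable_prod _ fun m hm => ?_
  rw [Finset.mem_Icc] at hm
  exact (hM.measurable_densityFactor_H hθ (Finset.mem_Icc.2 ⟨hm.1, hm.2.trans ht⟩)).mono
    (M.H_mono hm.2) le_rfl

/-- Split the density at time t. Its first part, times the indicator of `A`, is 𝓗_t-measurable and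
serves as `g` in the iterated formula; the indicator of the box is distributed over the later
factors. -/
lemma riskNeutral_inter_box [IsProbabilityMeasure μ] (hM : M.IsModel μ)
    (hθ : M.IsLinearKernel θ Δ) {t : ℤ} (ht : t ∈ Finset.Icc (0 : ℤ) T) {A : Set Ω}
    (hA : MeasurableSet[M.H t] A) {B : ℤ → Fin n → Set ℝ} (hB : ∀ m i, MeasurableSet (B m i)) :
    M.riskNeutral θ μ
        (A ∩ {ω | ∀ m ∈ Finset.Icc (t + 1) (T : ℤ), ∀ i, M.epsTilde θ m ω i ∈ B m i}) =
      (∫⁻ ω in A, ENNReal.ofReal (M.stateDensity θ t ω) ∂μ) *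
        ∏ m ∈ Finset.Icc (t + 1) (T : ℤ), ∏ i, gaussianReal 0 1 (B m i) := by
  have ht' := Finset.mem_Icc.1 ht
  obtain ⟨d, hd⟩ : ∃ d : ℕ, t + d = (T : ℤ) := ⟨(T - t).toNat, by omega⟩
  have hA0 : MeasurableSet A := hM.H_le t _ hA
  have hbox : MeasurableSet
      {ω | ∀ m ∈ Finset.Icc (t + 1) (T : ℤ), ∀ i, M.epsTilde θ m ω i ∈ B m i} := by
    have : {ω | ∀ m ∈ Finset.Icc (t + 1) (T : ℤ), ∀ i, M.epsTilde θ m ω i ∈ B m i} =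
        ⋂ m ∈ Finset.Icc (t + 1) (T : ℤ), ⋂ i, {ω | M.epsTilde θ m ω i ∈ B m i} := by
      ext ω
      simp
    rw [this]
    refine Finset.measurableSet_biInter _ fun m hm => MeasurableSet.iInter fun i => ?_
    rw [Finset.mem_Icc] at hm
    exact ((measurable_pi_apply i).comp ((hM.measurable_epsTilde_H hθ
      (Finset.mem_Icc.2 ⟨by omega, hm.2⟩)).mono (hM.H_le m) le_rfl)) (hB m i)
  have hg : Measurable[M.H t] (A.indicator fun ω => ENNReal.ofReal (M.stateDensity θ t ω)) :=
    Measurable.indicator (ENNReal.measurable_ofReal.comp (hM.measurable_stateDensity_H hθ ht'.2)) hA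
  have key := hM.lintegral_girsanov hθ ht'.1 hg hB d hd.le
  rw [hd] at key
  rw [riskNeutral, withDensity_apply _ (hA0.inter hbox), ← lintegral_indicator (hA0.inter hbox),
    ← lintegral_indicator hA0, ← key]
  refine lintegral_congr fun ω => ?_
  by_cases h1 : ω ∈ A
  · by_cases h2 : ∀ m ∈ Finset.Icc (t + 1) (T : ℤ), ∀ i, M.epsTilde θ m ω i ∈ B m i
    · have h12 : ω ∈ A ∩ {ω | ∀ m ∈ Finset.Icc (t + 1) (T : ℤ), ∀ i,
          M.epsTilde θ m ω i ∈ B m i} := ⟨h1, h2⟩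
      rw [Set.indicator_of_mem h12, Set.indicator_of_mem h1, stateDensity_eq_mul ht,
        ENNReal.ofReal_mul (show 0 ≤ M.stateDensity θ t ω from
          Finset.prod_nonneg fun m _ => (Real.exp_pos _).le),
        ENNReal.ofReal_prod_of_nonneg (f := fun m => M.densityFactor θ m ω)
          fun m _ => (Real.exp_pos _).le]
      congr 1
      refine Finset.prod_congr rfl fun m hm => ?_
      rw [Finset.prod_eq_one fun i _ => Set.indicator_of_mem (h2 m hm i) _, mul_one]
    · rw [Set.indicator_of_notMem fun h => h2 h.2]
      push Not at h2
      obtain ⟨m, hm, i, hi⟩ := h2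
      rw [Finset.prod_eq_zero hm, mul_zero]
      rw [Finset.prod_eq_zero (Finset.mem_univ i) (Set.indicator_of_notMem hi _), mul_zero]
  · rw [Set.indicator_of_notMem fun h => h1 h.1, Set.indicator_of_notMem h1, zero_mul]

/-- This is the martingale property of the density: with no constraint on the later noise, the later
factors integrate to 1. -/
lemma riskNeutral_apply [IsProbabilityMeasure μ] (hM : M.IsModel μ)
    (hθ : M.IsLinearKernel θ Δ) {t : ℤ} (ht : t ∈ Finset.Icc (0 : ℤ) T) {A : Set Ω}
    (hA : MeasurableSet[M.H t] A) :
    M.riskNeutral θ μ A = ∫⁻ ω in A, ENNReal.ofReal (M.stateDensity θ t ω) ∂μ := by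
  have := hM.riskNeutral_inter_box hθ ht hA (B := fun _ _ => Set.univ) fun _ _ => MeasurableSet.univ
  simpa using this

/-- The risk-neutral and the real-world measure agree on `𝓗_0`. -/
lemma riskNeutral_apply_H_zero [IsProbabilityMeasure μ] (hM : M.IsModel μ)
    (hθ : M.IsLinearKernel θ Δ) {A : Set Ω} (hA : MeasurableSet[M.H 0] A) :
    M.riskNeutral θ μ A = μ A := by
  rw [hM.riskNeutral_apply hθ (t := 0) (Finset.mem_Icc.2 ⟨le_rfl, by omega⟩) hA]
  simp [stateDensity]

lemma isProbabilityMeasure_riskNeutral [IsProbabilityMeasure μ] (hM : M.IsModel μ)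
    (hθ : M.IsLinearKernel θ Δ) : IsProbabilityMeasure (M.riskNeutral θ μ) :=
  ⟨by rw [hM.riskNeutral_apply_H_zero hθ MeasurableSet.univ, measure_univ]⟩

/-- Under the risk-neutral measure, the shifted noise after time `t` is standard normal
given `𝓗_t`. -/
lemma isStdNormalGiven_epsTilde [IsProbabilityMeasure μ] (hM : M.IsModel μ)
    (hθ : M.IsLinearKernel θ Δ) {t : ℤ} (ht : t ∈ Finset.Icc (0 : ℤ) T) :
    IsStdNormalGiven (M.H t) (M.riskNeutral θ μ)
      (fun ω (r : Times (t + 1) T × Fin n) => M.epsTilde θ r.1 ω r.2) := by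
  have ht' := Finset.mem_Icc.1 ht
  refine ⟨measurable_pi_lambda _ fun r => ?_, fun A hA B hB => ?_⟩
  · have hr := Finset.mem_Icc.1 r.1.2
    exact (measurable_pi_apply r.2).comp ((hM.measurable_epsTilde_H hθ
      (Finset.mem_Icc.2 ⟨by omega, hr.2⟩)).mono (hM.H_le _) le_rfl)
  · let B' : ℤ → Fin n → Set ℝ := fun m i =>
      if h : m ∈ Finset.Icc (t + 1) (T : ℤ) then B (⟨m, h⟩, i) else Set.univ
    have hB' : ∀ m i, MeasurableSet (B' m i) := fun m i => by
      by_cases h : m ∈ Finset.Icc (t + 1) (T : ℤ)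
      · simpa only [B', dif_pos h] using hB _
      · simp only [B', dif_neg h, MeasurableSet.univ]
    have hBr : ∀ r : Times (t + 1) T × Fin n, B' r.1 r.2 = B r := fun r => dif_pos r.1.2
    have key := hM.riskNeutral_inter_box hθ ht hA hB'
    rw [← hM.riskNeutral_apply hθ ht hA] at key
    have h1 : {ω | ∀ r : Times (t + 1) T × Fin n, M.epsTilde θ r.1 ω r.2 ∈ B r} =
        {ω | ∀ m ∈ Finset.Icc (t + 1) (T : ℤ), ∀ i, M.epsTilde θ m ω i ∈ B' m i} := by
      ext ω
      refine ⟨fun h m hm i => ?_, fun h r => ?_⟩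
      · have := h (⟨m, hm⟩, i)
        rwa [← hBr] at this
      · rw [← hBr]
        exact h r.1 r.1.2 r.2
    rw [h1, key, Fintype.prod_prod_type, ← Finset.prod_coe_sort]
    simp_rw [← hBr]

end IsModel

end MSVAR

/-! ### Conditional probabilities: change of measure and of conditioning -/

/-- Conditional probabilities agree under two measures that agree on a `σ`-field containing
the event and the conditioning `σ`-field. -/
lemma condExp_indicator_ae_eq_of_measure_eq {Ω : Type*} {𝒢 ℋ mΩ : MeasurableSpace Ω}
    {μ ν : Measure Ω} [IsFiniteMeasure μ] [IsFiniteMeasure ν] (h𝒢 : 𝒢 ≤ ℋ) (hℋ : ℋ ≤ mΩ)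
    (h : ∀ A, MeasurableSet[ℋ] A → ν A = μ A) {S : Set Ω} (hS : MeasurableSet[ℋ] S) :
    ν⟦S | 𝒢⟧ =ᵐ[μ] μ⟦S | 𝒢⟧ := by
  have hle := h𝒢.trans hℋ
  -- Functions measurable for `𝒢` see only the trimmed measures. Their equality transfers both the
  -- integrability and the set integrals of the `ν`-conditional probability to `μ`.
  have htrim : ν.trim hle = μ.trim hle := by
    refine @Measure.ext _ 𝒢 _ _ fun A hA => ?_
    rw [trim_measurableSet_eq hle hA, trim_measurableSet_eq hle hA, h A (h𝒢 _ hA)]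
  have hS0 : MeasurableSet S := hℋ _ hS
  have hint : Integrable (ν⟦S | 𝒢⟧) μ := by
    refine integrable_of_integrable_trim hle ?_
    rw [← htrim]
    exact integrable_condExp.trim hle stronglyMeasurable_condExp
  refine ae_eq_condExp_of_forall_setIntegral_eq hle ((integrable_const _).indicator hS0)
    (fun A _ _ => hint.integrableOn) (fun A hA _ => ?_)
    stronglyMeasurable_condExp.aestronglyMeasurable
  rw [setIntegral_trim hle stronglyMeasurable_condExp hA, ← htrim,
    ← setIntegral_trim hle stronglyMeasurable_condExp hA,
    setIntegral_condExp hle ((integrable_const _).indicator hS0) hA,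
    integral_indicator_const _ hS0, integral_indicator_const _ hS0,
    measureReal_restrict_apply hS0, measureReal_restrict_apply hS0, measureReal_def,
    measureReal_def, h _ (MeasurableSet.inter hS (h𝒢 _ hA))]

/-- Under conditional independence given `m`, conditioning on `m ∨ m₁` an event of `m₂` is the same
as conditioning on `m`. -/
lemma CondIndepFields.condExp_sup_ae_eq {Ω : Type*} {m m₁ m₂ mΩ : MeasurableSpace Ω}
    {μ : Measure Ω} [IsFiniteMeasure μ] (hm : m ≤ mΩ) (h₁ : m₁ ≤ mΩ) (h₂ : m₂ ≤ mΩ)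
    (hc : CondIndepFields μ m m₁ m₂) {A : Set Ω} (hA : MeasurableSet[m₂] A) :
    μ⟦A | m ⊔ m₁⟧ =ᵐ[μ] μ⟦A | m⟧ := by
  have hA0 : MeasurableSet A := h₂ _ hA
  have hind : ∀ S : Set Ω, MeasurableSet S → Integrable (S.indicator fun _ => (1 : ℝ)) μ :=
    fun S hS => (integrable_const _).indicator hS
  have hintA := hind A hA0
  have hint : Integrable (μ⟦A | m⟧) μ := integrable_condExp
  have hgm : StronglyMeasurable[m ⊔ m₁] (μ⟦A | m⟧) :=
    StronglyMeasurable.mono stronglyMeasurable_condExp le_sup_left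
  refine (ae_eq_condExp_of_forall_setIntegral_eq (sup_le hm h₁) hintA
    (fun S _ _ => hint.integrableOn) (fun S hS _ => ?_)
    hgm.aestronglyMeasurable).symm
  induction S, hS using MeasurableSpace.induction_on_inter
    (generateFrom_inter_eq_sup m m₁).symm (isPiSystem_inter_measurableSets m m₁) with
  | empty => simp
  | basic S hS =>
    obtain ⟨D, C, hD, hC, rfl⟩ := hS
    have hC0 : MeasurableSet C := h₁ _ hC
    have hD0 : MeasurableSet D := hm _ hD
    have e1 : ∫ ω in D ∩ C, (μ⟦A | m⟧) ω ∂μ =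
        ∫ ω in D, ((C.indicator fun _ => (1 : ℝ)) * μ⟦A | m⟧) ω ∂μ := by
      rw [← setIntegral_indicator hC0]
      congr 1
      ext ω
      by_cases h : ω ∈ C <;> simp [h]
    have hintm : Integrable ((C.indicator fun _ => (1 : ℝ)) * μ⟦A | m⟧) μ := by
      refine (hint.indicator hC0).congr (ae_of_all _ fun ω => ?_)
      by_cases h : ω ∈ C <;> simp [h]
    -- Pull the `m`-measurable factor μ⟦A | m⟧ out, then read the conditional product formula
    -- backwards.
    have e2 : μ[(C.indicator fun _ => (1 : ℝ)) * μ⟦A | m⟧ | m] =ᵐ[μ] μ⟦C ∩ A | m⟧ :=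
      (condExp_mul_of_stronglyMeasurable_right stronglyMeasurable_condExp hintm
        (hind C hC0)).trans (hc C A hC hA).symm
    rw [e1, ← setIntegral_condExp hm hintm hD,
      setIntegral_congr_ae hD0 (e2.mono fun ω h _ => h),
      setIntegral_condExp hm (hind _ (hC0.inter hA0)) hD, integral_indicator_const _ hA0,
      integral_indicator_const _ (hC0.inter hA0), measureReal_restrict_apply hA0,
      measureReal_restrict_apply (hC0.inter hA0)]
    congr 2
    ext ω
    simp only [Set.mem_inter_iff]
    tauto
  | compl S hS ih =>
    have hS0 := sup_le hm h₁ _ hS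
    rw [setIntegral_compl hS0 hint, setIntegral_compl hS0 hintA, ih (measure_lt_top _ _),
      integral_condExp hm]
  | iUnion f hd hf ih =>
    have hf0 : ∀ i, MeasurableSet (f i) := fun i => sup_le hm h₁ _ (hf i)
    rw [integral_iUnion hf0 hd hint.integrableOn, integral_iUnion hf0 hd hintA.integrableOn]
    exact tsum_congr fun i => ih i (measure_lt_top _ _)

/-- If each `A b` has the same conditional probability given `m` and `m'`, then so has `A s` for
every `m`-measurable finite-valued variable `s`. -/
lemma condExp_indicator_ae_eq_of_finite {Ω β : Type*} [Finite β] [MeasurableSpace β]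
    [MeasurableSingletonClass β] {m m' mΩ : MeasurableSpace Ω} {μ : Measure Ω} [IsFiniteMeasure μ]
    (hmm' : m ≤ m') (hm : m' ≤ mΩ) {s : Ω → β} (hs : Measurable[m] s) {A : β → Set Ω}
    (hA : ∀ b, MeasurableSet (A b)) (h : ∀ b, μ⟦A b | m'⟧ =ᵐ[μ] μ⟦A b | m⟧) :
    μ⟦{ω | ω ∈ A (s ω)} | m'⟧ =ᵐ[μ] μ⟦{ω | ω ∈ A (s ω)} | m⟧ := by
  classical
  have := Fintype.ofFinite β
  have hind : ∀ b, Integrable ((A b).indicator fun _ => (1 : ℝ)) μ :=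
    fun b => (integrable_const _).indicator (hA b)
  -- Split by the value of `s`: the indicators of {s = b} are measurable for both σ-fields and pass
  -- through the conditional expectations.
  have e : ({ω | ω ∈ A (s ω)}.indicator fun _ => (1 : ℝ)) =
      ∑ b, (s ⁻¹' {b}).indicator ((A b).indicator fun _ => (1 : ℝ)) := by
    ext ω
    rw [Finset.sum_apply, Finset.sum_eq_single (s ω)]
    · simp [Set.indicator]
    · intro b _ hb
      exact Set.indicator_of_notMem (fun hc => hb hc.symm) _
    · simp
  have hdec : ∀ m₀ : MeasurableSpace Ω, m ≤ m₀ → m₀ ≤ mΩ →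
      μ⟦{ω | ω ∈ A (s ω)} | m₀⟧ =ᵐ[μ] ∑ b, (s ⁻¹' {b}).indicator (μ⟦A b | m₀⟧) := by
    intro m₀ h0 h0'
    have hsb : ∀ b, MeasurableSet[m₀] (s ⁻¹' {b}) := fun b =>
      h0 _ (hs (measurableSet_singleton b))
    rw [e]
    refine (condExp_finsetSum (fun b _ => (hind b).indicator (h0' _ (hsb b))) m₀).trans ?_
    filter_upwards [ae_all_iff.2 fun b => condExp_indicator (hind b) (hsb b)] with ω hω
    simp only [Finset.sum_apply]
    exact Finset.sum_congr rfl fun b _ => hω b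
  refine (hdec m' hmm' hm).trans (Filter.EventuallyEq.trans ?_ (hdec m le_rfl (hmm'.trans hm)).symm)
  filter_upwards [ae_all_iff.2 h] with ω hω
  simp only [Finset.sum_apply, Set.indicator, hω]

/-! ### The linear system Ψ y = δ + Σ^{1/2} ε̃ and its solutions -/

namespace MSVAR

variable {Ω : Type*} {n k p T N n' k' p' q' Tpast : ℕ}
  (M : MSVAR Ω n k p T N n' k' p' q' Tpast)

/-- `diag(Σ_a^{1/2}, …, Σ_b^{1/2})`. -/
def cholDiag (a b : ℤ) (ω : Ω) : Matrix (Times a b × Fin n) (Times a b × Fin n) ℝ :=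
  Matrix.of fun r q => if r.1 = q.1 then M.chol r.1 ω r.2 q.2 else 0

lemma cholDiag_mulVec (a b : ℤ) (ω : Ω) (v : ℤ → Fin n → ℝ) (r : Times a b × Fin n) :
    (M.cholDiag a b ω *ᵥ fun q => v q.1 q.2) r = (M.chol r.1 ω *ᵥ v r.1) r.2 := by
  simp only [mulVec, dotProduct, Fintype.sum_prod_type, cholDiag, of_apply]
  rw [Finset.sum_eq_single r.1]
  · simp
  · intro u _ hu
    simp [Ne.symm hu]
  · simp

lemma isUnit_det_Psi (Δ : ℤ → Ω → Matrix (Fin n) (Cols k p n) ℝ) (a b : ℤ) (ω : Ω) :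
    IsUnit (M.Psi Δ a b a b ω).det := by
  -- `BlockTriangular` means upper triangular, hence the reversed order of times. The diagonal
  -- blocks are identities, so the determinant is 1.
  have htri : (M.Psi Δ a b a b ω).BlockTriangular
      (fun r : Times a b × Fin n => OrderDual.toDual (r.1 : ℤ)) := by
    intro r q h
    have h' : (r.1 : ℤ) < q.1 := h
    rw [Psi, of_apply, psiBlock, if_neg (by omega), dif_neg (by omega)]
    rfl
  rw [htri.det, Finset.prod_eq_one]
  · exact isUnit_one
  · intro x _
    have h1 : (M.Psi Δ a b a b ω).toSquareBlock
        (fun r : Times a b × Fin n => OrderDual.toDual (r.1 : ℤ)) x = 1 := by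
      ext r q
      rw [toSquareBlock_def, of_apply, Psi, of_apply, psiBlock, if_pos]
      · obtain ⟨⟨r1, r2⟩, hr⟩ := r
        obtain ⟨⟨q1, q2⟩, hq⟩ := q
        have h1 : r1 = q1 := Subtype.ext (OrderDual.toDual.injective (hr.trans hq.symm))
        simp only [one_apply, Subtype.mk.injEq, Prod.mk.injEq, h1, true_and]
      · exact OrderDual.toDual.injective (q.2.trans r.2.symm)
    rw [h1, det_one]

/-- The row of `Ψ y` at time `t` collects `y_t` and the lags at positive times. -/
lemma sum_psiBlock_mul (Δ : ℤ → Ω → Matrix (Fin n) (Cols k p n) ℝ) (ω : Ω) {t b : ℤ}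
    (ht : 1 ≤ t) (htb : t ≤ b) (i : Fin n) (v : ℤ → Fin n → ℝ) :
    ∑ u ∈ Finset.Icc 1 b, ∑ j, M.psiBlock Δ ω t u i j * v u j =
      v t i - ∑ l : Fin p, ∑ j, (M.PiAt t ω + Δ t ω) i (Sum.inr (l, j)) *
        (if t - ((l : ℕ) + 1 : ℤ) ≤ 0 then 0 else v (t - ((l : ℕ) + 1 : ℤ)) j) := by
  have hdiag : ∑ j, M.psiBlock Δ ω t t i j * v t j = v t i := by
    simp [psiBlock, one_apply]
  have hlag : ∀ l : Fin p, ∑ j, M.psiBlock Δ ω t (t - ((l : ℕ) + 1 : ℤ)) i j *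
      v (t - ((l : ℕ) + 1 : ℤ)) j = -∑ j, (M.PiAt t ω + Δ t ω) i (Sum.inr (l, j)) *
        v (t - ((l : ℕ) + 1 : ℤ)) j := by
    intro l
    have hl := l.2
    rw [← Finset.sum_neg_distrib]
    refine Finset.sum_congr rfl fun j _ => ?_
    rw [psiBlock, if_neg (by omega), dif_pos (by omega), Matrix.neg_apply, of_apply, neg_mul]
    refine congrArg (fun l' : Fin p => -((M.PiAt t ω + Δ t ω) i (Sum.inr (l', j)) * _))
      (Fin.ext ?_)
    simp only
    omega
  let s : Finset (Fin p) := Finset.univ.filter fun l => ¬ t - ((l : ℕ) + 1 : ℤ) ≤ 0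
  have hinj : Set.InjOn (fun l : Fin p => t - ((l : ℕ) + 1 : ℤ)) s := by
    intro l _ l' _ h
    ext
    simp only at h
    omega
  have hsub : s.image (fun l : Fin p => t - ((l : ℕ) + 1 : ℤ)) ⊆ (Finset.Icc 1 b).erase t := by
    intro u hu
    obtain ⟨l, hl, rfl⟩ := Finset.mem_image.1 hu
    have hl' := (Finset.mem_filter.1 hl).2
    simp only [Finset.mem_erase, Finset.mem_Icc]
    omega
  -- Off the diagonal, the nonzero blocks of the row can occur only at the times t - i ≥ 1, which
  -- are the injective image of the lags in `s`.
  rw [← Finset.add_sum_erase _ _ (Finset.mem_Icc.2 ⟨ht, htb⟩), hdiag, sub_eq_add_neg,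
    ← Finset.sum_subset hsub, Finset.sum_image hinj, ← Finset.sum_neg_distrib, Finset.sum_filter]
  · congr 1
    refine Finset.sum_congr rfl fun l _ => ?_
    by_cases h : t - ((l : ℕ) + 1 : ℤ) ≤ 0
    · simp [h]
    · rw [if_pos h, hlag]
      simp only [if_neg h]
  · intro u hu hus
    rw [Finset.mem_erase, Finset.mem_Icc] at hu
    refine Finset.sum_eq_zero fun j _ => ?_
    rw [psiBlock, if_neg hu.1, dif_neg, Matrix.zero_apply, zero_mul]
    rintro ⟨h1, h2⟩
    refine hus (Finset.mem_image.2 ⟨⟨(t - u - 1).toNat, by omega⟩, ?_, ?_⟩)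
    · simp only [s, Finset.mem_filter, Finset.mem_univ, true_and]
      omega
    · simp only
      omega

variable {M} [mΩ : MeasurableSpace Ω] {μ : Measure Ω}
  {θ : ℤ → Ω → Fin n → ℝ} {Δ : ℤ → Ω → Matrix (Fin n) (Cols k p n) ℝ}

namespace IsModel

lemma SigDiag_eq (hM : M.IsModel μ) {a b : ℤ} (ha : 1 ≤ a) (hb : b ≤ T) (ω : Ω) :
    M.SigDiag a b ω = M.cholDiag a b ω * (M.cholDiag a b ω)ᵀ := by
  ext r q
  have hr := Finset.mem_Icc.1 r.1.2
  have hq : (M.cholDiag a b ω * (M.cholDiag a b ω)ᵀ) r q =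
      ∑ u, ∑ j, M.cholDiag a b ω r (u, j) * M.cholDiag a b ω q (u, j) := by
    rw [mul_apply, Fintype.sum_prod_type]
    rfl
  rw [hq, Finset.sum_eq_single r.1]
  · simp only [SigDiag, cholDiag, of_apply]
    rw [← (hM.cholesky r.1 (Finset.mem_Icc.2 ⟨by omega, by omega⟩) ω).2.2]
    by_cases h : r.1 = q.1
    · simp [h, mul_apply]
    · simp [h, Ne.symm h]
  · intro u _ hu
    simp [cholDiag, Ne.symm hu]
  · simp

/-- Replacing ε by ε̃ + η in the residual produces the drift Σ_t^{1/2} η_t = θ_t. -/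
lemma y_eq_girsanov (hM : M.IsModel μ) (θ : ℤ → Ω → Fin n → ℝ) {t : ℤ}
    (ht : t ∈ Finset.Icc (1 : ℤ) T) (ω : Ω) :
    M.y t ω = M.PiAt t ω *ᵥ M.lagged t ω + θ t ω + M.chol t ω *ᵥ M.epsTilde θ t ω := by
  rw [hM.equation t ht ω, epsTilde, mulVec_sub, eta, mulVec_mulVec,
    mul_nonsing_inv _ (hM.isUnit_det_chol ht ω), one_mulVec, xi]
  abel

/-- The rows of the system `Ψ y = δ + Σ^{1/2} ε̃`. -/
lemma sum_psiBlock_mul_y (hM : M.IsModel μ) (hθ : M.IsLinearKernel θ Δ) {t b : ℤ}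
    (ht : t ∈ Finset.Icc (1 : ℤ) T) (htb : t ≤ b) (i : Fin n) (ω : Ω) :
    ∑ u ∈ Finset.Icc 1 b, ∑ j, M.psiBlock Δ ω t u i j * M.y u ω j =
      M.deltaBlock Δ ω t i + (M.chol t ω *ᵥ M.epsTilde θ t ω) i := by
  rw [M.sum_psiBlock_mul Δ ω (Finset.mem_Icc.1 ht).1 htb i (fun u => M.y u ω),
    hM.y_eq_girsanov θ ht ω, (hθ t ht).2.2 ω, ← add_mulVec, Pi.add_apply, add_sub_right_comm]
  congr 1
  simp only [deltaBlock, mulVec, dotProduct, lagged, Fintype.sum_sum_type, Sum.elim_inl,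
    Sum.elim_inr]
  rw [add_sub_assoc, ← Fintype.sum_prod_type', ← Finset.sum_sub_distrib]
  congr 1
  -- Lag by lag: once the lags at positive times have moved into Ψ y, exactly those at times ≤ 0 are
  -- left, and they belong to δ.
  refine Finset.sum_congr rfl fun c _ => ?_
  by_cases h : t - ((c.1 : ℕ) + 1 : ℤ) ≤ 0 <;> simp [h]

lemma Psi_mulVec_yStack_add (hM : M.IsModel μ) (hθ : M.IsLinearKernel θ Δ) {t b : ℤ}
    (ht : 0 ≤ t) (htb : t ≤ b) (hb : b ≤ T) (ω : Ω) :
    M.Psi Δ (t + 1) b 1 t ω *ᵥ M.yStack 1 t ω + M.Psi Δ (t + 1) b (t + 1) b ω *ᵥ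
        M.yStack (t + 1) b ω =
      M.delta Δ (t + 1) b ω + M.cholDiag (t + 1) b ω *ᵥ
        (fun r : Times (t + 1) b × Fin n => M.epsTilde θ r.1 ω r.2) := by
  ext r
  have hr := Finset.mem_Icc.1 r.1.2
  have hsum : ∀ c d : ℤ, (M.Psi Δ (t + 1) b c d ω *ᵥ M.yStack c d ω) r =
      ∑ u ∈ Finset.Icc c d, ∑ j, M.psiBlock Δ ω r.1 u r.2 j * M.y u ω j := by
    intro c d
    simp only [mulVec, dotProduct, Fintype.sum_prod_type, Psi, of_apply, yStack]
    exact Finset.sum_coe_sort (Finset.Icc c d)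
      fun u => ∑ j, M.psiBlock Δ ω r.1 u r.2 j * M.y u ω j
  have hIcc : Finset.Icc 1 b = Finset.Icc 1 t ∪ Finset.Icc (t + 1) b := by
    ext x
    simp only [Finset.mem_Icc, Finset.mem_union]
    omega
  have hdisj : Disjoint (Finset.Icc 1 t) (Finset.Icc (t + 1) b) := by
    rw [Finset.disjoint_left]
    intro x
    simp only [Finset.mem_Icc]
    omega
  rw [Pi.add_apply, Pi.add_apply, hsum, hsum, ← Finset.sum_union hdisj, ← hIcc,
    hM.sum_psiBlock_mul_y hθ (Finset.mem_Icc.2 ⟨by omega, by omega⟩) hr.2,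
    M.cholDiag_mulVec _ _ ω (fun u => M.epsTilde θ u ω)]
  rfl

/-- Solution of the system for the times after `t`, given the past. -/
lemma yStack_future_eq (hM : M.IsModel μ) (hθ : M.IsLinearKernel θ Δ) {t b : ℤ}
    (ht : 0 ≤ t) (htb : t ≤ b) (hb : b ≤ T) (ω : Ω) :
    M.yStack (t + 1) b ω = (M.Psi Δ (t + 1) b (t + 1) b ω)⁻¹ *ᵥ
        (M.delta Δ (t + 1) b ω - M.Psi Δ (t + 1) b 1 t ω *ᵥ M.yStack 1 t ω) +
      ((M.Psi Δ (t + 1) b (t + 1) b ω)⁻¹ * M.cholDiag (t + 1) b ω) *ᵥ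
        (fun r : Times (t + 1) b × Fin n => M.epsTilde θ r.1 ω r.2) := by
  have h := hM.Psi_mulVec_yStack_add hθ ht htb hb ω
  rw [← mulVec_mulVec, ← mulVec_add]
  rw [sub_add_eq_add_sub, ← h, add_sub_cancel_left, mulVec_mulVec,
    nonsing_inv_mul _ (M.isUnit_det_Psi Δ _ _ ω), one_mulVec]

/-- Solution of the system for the times up to `b`. -/
lemma yStack_eq (hM : M.IsModel μ) (hθ : M.IsLinearKernel θ Δ) {b : ℤ}
    (h0 : 0 ≤ b) (hb : b ≤ T) (ω : Ω) :
    M.yStack 1 b ω = (M.Psi Δ 1 b 1 b ω)⁻¹ *ᵥ M.delta Δ 1 b ω +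
      ((M.Psi Δ 1 b 1 b ω)⁻¹ * M.cholDiag 1 b ω) *ᵥ
        (fun r : Times 1 b × Fin n => M.epsTilde θ r.1 ω r.2) := by
  have h := hM.yStack_future_eq hθ le_rfl h0 hb ω
  -- At `t = 0` the past block has an empty set of times, so the term with Ψ₂₁ disappears.
  have : IsEmpty (Times 1 0) := ⟨fun u => by have := Finset.mem_Icc.1 u.2; omega⟩
  have he : M.yStack 1 0 ω = 0 := Subsingleton.elim _ _
  rw [he, mulVec_zero, sub_zero] at h
  exact h

/-- Solution of the system for the times after `t`, in terms of initial values. -/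
lemma yStack_future_eq_initial (hM : M.IsModel μ) (hθ : M.IsLinearKernel θ Δ) {t : ℤ}
    (ht : 0 ≤ t) (htT : t ≤ T) (ω : Ω) :
    M.yStack (t + 1) T ω = (M.C21 Δ t ω *ᵥ M.delta Δ 1 t ω +
        (M.Psi Δ (t + 1) T (t + 1) T ω)⁻¹ *ᵥ M.delta Δ (t + 1) T ω) +
      (M.C21 Δ t ω * M.cholDiag 1 t ω) *ᵥ
        (fun r : Times 1 t × Fin n => M.epsTilde θ r.1 ω r.2) +
      ((M.Psi Δ (t + 1) T (t + 1) T ω)⁻¹ * M.cholDiag (t + 1) T ω) *ᵥ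
        (fun r : Times (t + 1) T × Fin n => M.epsTilde θ r.1 ω r.2) := by
  -- Substitute the solution for the past into the one for the future; every past term acquires the
  -- factor -Ψ₂₂⁻¹Ψ₂₁Ψ₁₁⁻¹.
  rw [hM.yStack_future_eq hθ ht htT le_rfl ω, hM.yStack_eq hθ ht htT ω]
  simp only [C21, mulVec_sub, mulVec_add, mulVec_mulVec, neg_mulVec, Matrix.mul_assoc,
    Matrix.neg_mul]
  abel

end IsModel

end MSVAR

/-! ### The conditional laws under the risk-neutral measure -/

namespace MSVAR

variable {Ω : Type*} {n k p T N n' k' p' q' Tpast : ℕ}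
  {M : MSVAR Ω n k p T N n' k' p' q' Tpast}
  {θ : ℤ → Ω → Fin n → ℝ} {Δ : ℤ → Ω → Matrix (Fin n) (Cols k p n) ℝ}

section Measurability

variable {𝒢 : MeasurableSpace Ω}

lemma measurable_Psi_sub {a b c d : ℤ} (ha : 1 ≤ a) (hb : b ≤ T) (hc : 1 ≤ c) (hd : d ≤ T)
    (h : Measurable (M.Psi Δ 1 T 1 T)) : Measurable (M.Psi Δ a b c d) :=
  Matrix.measurable_of_entries fun r q => h.matrix_entry
    (⟨r.1, Finset.Icc_subset_Icc ha hb r.1.2⟩, r.2) (⟨q.1, Finset.Icc_subset_Icc hc hd q.1.2⟩, q.2)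

lemma measurable_delta_sub {a b : ℤ} (ha : 1 ≤ a) (hb : b ≤ T)
    (h : Measurable (M.delta Δ 1 T)) : Measurable (M.delta Δ a b) :=
  measurable_pi_lambda _ fun r =>
    measurable_pi_iff.1 h (⟨r.1, Finset.Icc_subset_Icc ha hb r.1.2⟩, r.2)

lemma measurable_SigDiag_sub {a b : ℤ} (ha : 1 ≤ a) (hb : b ≤ T)
    (h : Measurable (M.SigDiag 1 T)) : Measurable (M.SigDiag a b) := by
  refine Matrix.measurable_of_entries fun r q => ?_
  have := h.matrix_entry (⟨r.1, Finset.Icc_subset_Icc ha hb r.1.2⟩, r.2)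
    (⟨q.1, Finset.Icc_subset_Icc ha hb q.1.2⟩, q.2)
  simpa only [SigDiag, of_apply, Subtype.mk.injEq, ← Subtype.ext_iff] using this

lemma measurable_yStack_H {t : ℤ} : Measurable[M.H t] (M.yStack 1 t) :=
  @measurable_pi_lambda _ _ _ (M.H t) _ _ fun r => by
    have hr := Finset.mem_Icc.1 r.1.2
    exact (measurable_pi_apply r.2).comp (M.measurable_y_H (by omega) hr.2)

lemma measurable_sVec : Measurable[M.sigmaRegimes T] M.sVec :=
  @measurable_pi_lambda _ _ _ (M.sigmaRegimes T) _ _ fun t => M.measurable_s_sigmaRegimes t.2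

end Measurability

namespace IsModel

/-- Each Σ_t is a diagonal block and determines its Cholesky factor measurably, so an assumption on
Σ passes to the matrix that multiplies the noise. -/
lemma measurable_cholDiag {𝒢 : MeasurableSpace Ω} [MeasurableSpace Ω] {μ : Measure Ω}
    (hM : M.IsModel μ) {a b : ℤ} (ha : 1 ≤ a) (hb : b ≤ T) (h : Measurable[𝒢] (M.SigDiag a b)) :
    Measurable[𝒢] (M.cholDiag a b) := by
  refine @Matrix.measurable_of_entries _ _ _ 𝒢 _ fun r q => ?_
  by_cases hrq : r.1 = q.1
  · have hSig : Measurable[𝒢] (M.Sig r.1) := by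
      refine @Matrix.measurable_of_entries _ _ _ 𝒢 _ fun i j => ?_
      have := @Measurable.matrix_entry _ _ _ 𝒢 _ h (r.1, i) (r.1, j)
      simpa only [SigDiag, of_apply, if_true] using this
    simp only [cholDiag, of_apply, if_pos hrq]
    exact @Measurable.matrix_entry _ _ _ 𝒢 _
      (hM.measurable_chol (Finset.Icc_subset_Icc ha hb r.1.2) hSig) r.2 q.2
  · simp only [cholDiag, of_apply, if_neg hrq]
    exact measurable_const

lemma condExp_riskNeutral_ae_eq {𝒢 : MeasurableSpace Ω} [MeasurableSpace Ω] {μ : Measure Ω}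
    [IsProbabilityMeasure μ] (hM : M.IsModel μ) (hθ : M.IsLinearKernel θ Δ)
    (h𝒢 : 𝒢 ≤ M.H 0) {S : Set Ω} (hS : MeasurableSet[M.H 0] S) :
    (M.riskNeutral θ μ)⟦S | 𝒢⟧ =ᵐ[μ] μ⟦S | 𝒢⟧ := by
  have := hM.isProbabilityMeasure_riskNeutral hθ
  exact condExp_indicator_ae_eq_of_measure_eq h𝒢 (hM.H_le 0)
    (fun A hA => hM.riskNeutral_apply_H_zero hθ hA) hS

variable [mΩ : MeasurableSpace Ω] {μ : Measure Ω}

lemma mul_SigDiag_mul_transpose (hM : M.IsModel μ) {ι : Type*} {a b : ℤ} (ha : 1 ≤ a) (hb : b ≤ T)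
    (ω : Ω) (C : Matrix ι (Times a b × Fin n) ℝ) :
    C * M.SigDiag a b ω * Cᵀ = (C * M.cholDiag a b ω) * (C * M.cholDiag a b ω)ᵀ := by
  rw [hM.SigDiag_eq ha hb, transpose_mul]
  simp only [Matrix.mul_assoc]

variable [IsProbabilityMeasure μ]

lemma isStdNormalGiven_epsTilde_zero (hM : M.IsModel μ) (hθ : M.IsLinearKernel θ Δ) :
    IsStdNormalGiven (M.H 0) (M.riskNeutral θ μ)
      (fun ω (r : Times 1 T × Fin n) => M.epsTilde θ r.1 ω r.2) :=
  hM.isStdNormalGiven_epsTilde hθ (t := 0) (Finset.mem_Icc.2 ⟨le_rfl, by omega⟩)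

lemma condGaussian_past (hM : M.IsModel μ) (hθ : M.IsLinearKernel θ Δ) {t : ℤ}
    (ht : t ∈ Finset.Icc (0 : ℤ) T) (hPsi : Measurable[M.H 0] (M.Psi Δ 1 t 1 t))
    (hdelta : Measurable[M.H 0] (M.delta Δ 1 t)) (hSig : Measurable[M.H 0] (M.SigDiag 1 t)) :
    CondGaussian (M.riskNeutral θ μ) (M.H 0) (M.yStack 1 t)
      (fun ω => (M.Psi Δ 1 t 1 t ω)⁻¹ *ᵥ M.delta Δ 1 t ω)
      (fun ω => (M.Psi Δ 1 t 1 t ω)⁻¹ * M.SigDiag 1 t ω * ((M.Psi Δ 1 t 1 t ω)⁻¹)ᵀ) := by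
  rw [Finset.mem_Icc] at ht
  have := hM.isProbabilityMeasure_riskNeutral hθ
  have hstd := (hM.isStdNormalGiven_epsTilde_zero hθ).comp_injective
    (e := fun r : Times 1 t × Fin n =>
      ((⟨r.1, Finset.Icc_subset_Icc_right ht.2 r.1.2⟩ : Times 1 T), r.2))
    (by
      rintro ⟨⟨u, hu⟩, i⟩ ⟨⟨u', hu'⟩, i'⟩ h
      simpa using h)
  have hinv := @Measurable.matrix_inv _ _ _ _ (M.H 0) _ hPsi
  refine hstd.condGaussian (hM.H_le 0)
    (B := fun ω => (M.Psi Δ 1 t 1 t ω)⁻¹ * M.cholDiag 1 t ω)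
    (@Measurable.matrix_mulVec _ _ _ _ (M.H 0) _ _ hinv hdelta)
    (@Measurable.matrix_mul _ _ _ _ _ (M.H 0) _ _ hinv
      (hM.measurable_cholDiag le_rfl ht.2 hSig))
    (fun ω => hM.mul_SigDiag_mul_transpose le_rfl ht.2 ω _)
    (fun ω => hM.yStack_eq hθ ht.1 ht.2 ω)

lemma condGaussian_future_initial (hM : M.IsModel μ) (hθ : M.IsLinearKernel θ Δ) {t : ℤ}
    (ht : t ∈ Finset.Icc (0 : ℤ) T) (hPsi : Measurable[M.H 0] (M.Psi Δ 1 T 1 T))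
    (hdelta : Measurable[M.H 0] (M.delta Δ 1 T)) (hSig : Measurable[M.H 0] (M.SigDiag 1 T)) :
    CondGaussian (M.riskNeutral θ μ) (M.H 0) (M.yStack (t + 1) T)
      (fun ω => M.C21 Δ t ω *ᵥ M.delta Δ 1 t ω +
        (M.Psi Δ (t + 1) T (t + 1) T ω)⁻¹ *ᵥ M.delta Δ (t + 1) T ω)
      (fun ω => M.C21 Δ t ω * M.SigDiag 1 t ω * (M.C21 Δ t ω)ᵀ +
        (M.Psi Δ (t + 1) T (t + 1) T ω)⁻¹ * M.SigDiag (t + 1) T ω *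
          ((M.Psi Δ (t + 1) T (t + 1) T ω)⁻¹)ᵀ) := by
  rw [Finset.mem_Icc] at ht
  have ht1 : 1 ≤ t + 1 := by omega
  have := hM.isProbabilityMeasure_riskNeutral hθ
  have hstd := (hM.isStdNormalGiven_epsTilde_zero hθ).comp_injective
    -- The noise before and after time t is taken as one vector indexed by a disjoint sum. The
    -- coefficient is then [C₂₁ Σ̄^{1/2} : Ψ₂₂⁻¹ (Σ̄^c)^{1/2}], and its product with its transpose
    -- is the sum of the two covariances.
    (e := Sum.elim
      (fun r : Times 1 t × Fin n =>
        ((⟨r.1, Finset.Icc_subset_Icc_right ht.2 r.1.2⟩ : Times 1 T), r.2))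
      (fun r : Times (t + 1) T × Fin n =>
        ((⟨r.1, Finset.Icc_subset_Icc_left ht1 r.1.2⟩ : Times 1 T), r.2)))
    (by
      rintro (⟨⟨u, hu⟩, i⟩ | ⟨⟨u, hu⟩, i⟩) (⟨⟨u', hu'⟩, i'⟩ | ⟨⟨u', hu'⟩, i'⟩) h
      · simpa using h
      · simp only [Sum.elim_inl, Sum.elim_inr, Prod.mk.injEq, Subtype.mk.injEq] at h
        rw [Finset.mem_Icc] at hu hu'
        omega
      · simp only [Sum.elim_inl, Sum.elim_inr, Prod.mk.injEq, Subtype.mk.injEq] at h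
        rw [Finset.mem_Icc] at hu hu'
        omega
      · simpa using h)
  have hinv2 := @Measurable.matrix_inv _ _ _ _ (M.H 0) _
    (measurable_Psi_sub (a := t + 1) ht1 le_rfl ht1 le_rfl hPsi)
  have hinv1 := @Measurable.matrix_inv _ _ _ _ (M.H 0) _
    (measurable_Psi_sub (b := t) le_rfl ht.2 le_rfl ht.2 hPsi)
  have hC : Measurable[M.H 0] (M.C21 Δ t) :=
    @Measurable.matrix_neg _ _ _ (M.H 0) _ (@Measurable.matrix_mul _ _ _ _ _ (M.H 0) _ _
      (@Measurable.matrix_mul _ _ _ _ _ (M.H 0) _ _ hinv2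
        (measurable_Psi_sub ht1 le_rfl le_rfl ht.2 hPsi)) hinv1)
  have hB1 := @Measurable.matrix_mul _ _ _ _ _ (M.H 0) _ _ hC
    (hM.measurable_cholDiag le_rfl ht.2 (measurable_SigDiag_sub le_rfl ht.2 hSig))
  have hB2 := @Measurable.matrix_mul _ _ _ _ _ (M.H 0) _ _ hinv2
    (hM.measurable_cholDiag ht1 le_rfl (measurable_SigDiag_sub ht1 le_rfl hSig))
  refine hstd.condGaussian (hM.H_le 0)
    (B := fun ω => fromCols (M.C21 Δ t ω * M.cholDiag 1 t ω)
      ((M.Psi Δ (t + 1) T (t + 1) T ω)⁻¹ * M.cholDiag (t + 1) T ω))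
    (Measurable.add
      (@Measurable.matrix_mulVec _ _ _ _ (M.H 0) _ _ hC (measurable_delta_sub le_rfl ht.2 hdelta))
      (@Measurable.matrix_mulVec _ _ _ _ (M.H 0) _ _ hinv2
        (measurable_delta_sub ht1 le_rfl hdelta)))
    (@Matrix.measurable_of_entries _ _ _ (M.H 0) _ fun i j => ?_) (fun ω => ?_) (fun ω => ?_)
  · rcases j with j | j
    · exact @Measurable.matrix_entry _ _ _ (M.H 0) _ hB1 i j
    · exact @Measurable.matrix_entry _ _ _ (M.H 0) _ hB2 i j
  · rw [transpose_fromCols, fromCols_mul_fromRows, hM.mul_SigDiag_mul_transpose le_rfl ht.2,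
      hM.mul_SigDiag_mul_transpose ht1 le_rfl]
  · rw [fromCols_mulVec, ← add_assoc]
    exact hM.yStack_future_eq_initial hθ ht.1 ht.2 ω

lemma condGaussian_future (hM : M.IsModel μ) (hθ : M.IsLinearKernel θ Δ) {t : ℤ}
    (ht : t ∈ Finset.Icc (0 : ℤ) T) (hPsi21 : Measurable[M.H t] (M.Psi Δ (t + 1) T 1 t))
    (hPsi22 : Measurable[M.H t] (M.Psi Δ (t + 1) T (t + 1) T))
    (hdelta : Measurable[M.H t] (M.delta Δ (t + 1) T))
    (hSig : Measurable[M.H t] (M.SigDiag (t + 1) T)) :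
    CondGaussian (M.riskNeutral θ μ) (M.H t) (M.yStack (t + 1) T)
      (fun ω => (M.Psi Δ (t + 1) T (t + 1) T ω)⁻¹ *ᵥ
        (M.delta Δ (t + 1) T ω - M.Psi Δ (t + 1) T 1 t ω *ᵥ M.yStack 1 t ω))
      (fun ω => (M.Psi Δ (t + 1) T (t + 1) T ω)⁻¹ * M.SigDiag (t + 1) T ω *
        ((M.Psi Δ (t + 1) T (t + 1) T ω)⁻¹)ᵀ) := by
  have ht' := Finset.mem_Icc.1 ht
  have ht1 : 1 ≤ t + 1 := by omega
  have := hM.isProbabilityMeasure_riskNeutral hθ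
  have hinv := @Measurable.matrix_inv _ _ _ _ (M.H t) _ hPsi22
  exact (hM.isStdNormalGiven_epsTilde hθ ht).condGaussian (hM.H_le t)
    (B := fun ω => (M.Psi Δ (t + 1) T (t + 1) T ω)⁻¹ * M.cholDiag (t + 1) T ω)
    (@Measurable.matrix_mulVec _ _ _ _ (M.H t) _ _ hinv
      (hdelta.sub (@Measurable.matrix_mulVec _ _ _ _ (M.H t) _ _ hPsi21 measurable_yStack_H)))
    (@Measurable.matrix_mul _ _ _ _ _ (M.H t) _ _ hinv
      (hM.measurable_cholDiag ht1 le_rfl hSig))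
    (fun ω => hM.mul_SigDiag_mul_transpose ht1 le_rfl ω _)
    (fun ω => hM.yStack_future_eq hθ ht'.1 ht'.2 le_rfl ω)

lemma condGaussian_step (hM : M.IsModel μ) (hθ : M.IsLinearKernel θ Δ) {t : ℤ}
    (ht : t ∈ Finset.Icc (1 : ℤ) T) :
    CondGaussian (M.riskNeutral θ μ) (M.H (t - 1)) (M.y t)
      (fun ω => M.PiAt t ω *ᵥ M.lagged t ω + θ t ω) (M.Sig t) := by
  have ht' := Finset.mem_Icc.1 ht
  have := hM.isProbabilityMeasure_riskNeutral hθ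
  -- Given 𝓗_{t-1} the noise from time `t - 1 + 1` on is standard normal; keep its first block.
  have hstd := (hM.isStdNormalGiven_epsTilde hθ (t := t - 1)
    (Finset.mem_Icc.2 ⟨by omega, by omega⟩)).comp_injective
    (e := fun i : Fin n =>
      ((⟨t, Finset.mem_Icc.2 ⟨by omega, ht'.2⟩⟩ : Times (t - 1 + 1) T), i))
    (fun i j h => by simpa using h)
  exact hstd.condGaussian (hM.H_le _)
    ((M.measurable_mean_H ht).add ((hθ t ht).1.mono (M.IBefore_le_H ht) le_rfl))
    (hM.measurable_chol_H ht) (fun ω => (hM.cholesky t ht ω).2.2.symm)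
    (fun ω => hM.y_eq_girsanov θ ht ω)

lemma condExp_coeff_ae_eq (hM : M.IsModel μ) {S : Set Ω} (hS : MeasurableSet[M.sigmaCoeff] S) :
    μ⟦S | M.F0 ⊔ M.sigmaRegimes T ⊔ M.sigmaTrans⟧ =ᵐ[μ] μ⟦S | M.F0 ⊔ M.sigmaRegimes T⟧ :=
  hM.trans_condIndep.condExp_sup_ae_eq (sup_le hM.F0_le (hM.sigmaRegimes_le T)) hM.sigmaTrans_le
    hM.sigmaCoeff_le hS

end IsModel

end MSVAR

theorem theorem2 {Ω : Type*} [MeasurableSpace Ω] (μ : Measure Ω) [IsProbabilityMeasure μ]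
    {n k p T N n' k' p' q' Tpast : ℕ} (M : MSVAR Ω n k p T N n' k' p' q' Tpast)
    (hM : M.IsModel μ)
    (θ : ℤ → Ω → Fin n → ℝ) (Δ : ℤ → Ω → Matrix (Fin n) (Cols k p n) ℝ)
    (hθ : M.IsLinearKernel θ Δ) :
    IsProbabilityMeasure (M.riskNeutral θ μ) ∧
    -- law of `y` given `𝓗_0`
    (Measurable[M.H 0] (M.Psi Δ 1 T 1 T) → Measurable[M.H 0] (M.delta Δ 1 T) →
      Measurable[M.H 0] (M.SigDiag 1 T) →
      CondGaussian (M.riskNeutral θ μ) (M.H 0) (M.yStack 1 T)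
        (fun ω => (M.Psi Δ 1 T 1 T ω)⁻¹ *ᵥ M.delta Δ 1 T ω)
        (fun ω => (M.Psi Δ 1 T 1 T ω)⁻¹ * M.SigDiag 1 T ω * ((M.Psi Δ 1 T 1 T ω)⁻¹)ᵀ)) ∧
    (∀ t ∈ Finset.Icc (0 : ℤ) T,
      -- law of the past block given `𝓗_0`
      (Measurable[M.H 0] (M.Psi Δ 1 t 1 t) → Measurable[M.H 0] (M.delta Δ 1 t) →
        Measurable[M.H 0] (M.SigDiag 1 t) →
        CondGaussian (M.riskNeutral θ μ) (M.H 0) (M.yStack 1 t)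
          (fun ω => (M.Psi Δ 1 t 1 t ω)⁻¹ *ᵥ M.delta Δ 1 t ω)
          (fun ω => (M.Psi Δ 1 t 1 t ω)⁻¹ * M.SigDiag 1 t ω * ((M.Psi Δ 1 t 1 t ω)⁻¹)ᵀ)) ∧
      -- law of the future block given `𝓗_0`
      (Measurable[M.H 0] (M.Psi Δ 1 T 1 T) → Measurable[M.H 0] (M.delta Δ 1 T) →
        Measurable[M.H 0] (M.SigDiag 1 T) →
        CondGaussian (M.riskNeutral θ μ) (M.H 0) (M.yStack (t + 1) T)
          (fun ω => M.C21 Δ t ω *ᵥ M.delta Δ 1 t ω +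
            (M.Psi Δ (t + 1) T (t + 1) T ω)⁻¹ *ᵥ M.delta Δ (t + 1) T ω)
          (fun ω => M.C21 Δ t ω * M.SigDiag 1 t ω * (M.C21 Δ t ω)ᵀ +
            (M.Psi Δ (t + 1) T (t + 1) T ω)⁻¹ * M.SigDiag (t + 1) T ω *
              ((M.Psi Δ (t + 1) T (t + 1) T ω)⁻¹)ᵀ)) ∧
      -- law of the future block given `𝓗_t`
      (Measurable[M.H t] (M.Psi Δ (t + 1) T 1 t) →
        Measurable[M.H t] (M.Psi Δ (t + 1) T (t + 1) T) →
        Measurable[M.H t] (M.delta Δ (t + 1) T) → Measurable[M.H t] (M.SigDiag (t + 1) T) →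
        CondGaussian (M.riskNeutral θ μ) (M.H t) (M.yStack (t + 1) T)
          (fun ω => (M.Psi Δ (t + 1) T (t + 1) T ω)⁻¹ *ᵥ
            (M.delta Δ (t + 1) T ω - M.Psi Δ (t + 1) T 1 t ω *ᵥ M.yStack 1 t ω))
          (fun ω => (M.Psi Δ (t + 1) T (t + 1) T ω)⁻¹ * M.SigDiag (t + 1) T ω *
            ((M.Psi Δ (t + 1) T (t + 1) T ω)⁻¹)ᵀ))) ∧
    -- one-step law
    (∀ t ∈ Finset.Icc (1 : ℤ) T,
      CondGaussian (M.riskNeutral θ μ) (M.H (t - 1)) (M.y t)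
        (fun ω => M.PiAt t ω *ᵥ M.lagged t ω + θ t ω) (M.Sig t)) ∧
    -- posterior law of `(s, P)` given `𝓕_0`
    (∀ B : Set ((Times 1 T → Fin N) × Matrix (Fin N) (Fin N) ℝ), MeasurableSet B →
      (M.riskNeutral θ μ)⟦{ω | (M.sVec ω, M.trans ω) ∈ B} | M.F0⟧ =ᵐ[μ]
        μ⟦{ω | (M.sVec ω, M.trans ω) ∈ B} | M.F0⟧) ∧
    -- law of `(Π, Γ)`, as the coefficient matrices of all regimes
    (∀ B : Set ((Fin N → Matrix (Fin n) (Cols k p n) ℝ) ×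
        (Fin N → Matrix (Fin n') (Cols k' (p' + q') n') ℝ)), MeasurableSet B →
      (M.riskNeutral θ μ)⟦{ω | (fun j => M.Pi j ω, fun j => M.Gam j ω) ∈ B} |
          M.F0 ⊔ M.sigmaRegimes T ⊔ M.sigmaTrans⟧ =ᵐ[μ]
        μ⟦{ω | (fun j => M.Pi j ω, fun j => M.Gam j ω) ∈ B} | M.F0 ⊔ M.sigmaRegimes T⟧) ∧
    -- law of `(Π, Γ)`, as the stacked matrices `[Π_1 : ⋯ : Π_T]` and `[Γ_1 : ⋯ : Γ_T]`
    (∀ B : Set ((Times 1 T → Matrix (Fin n) (Cols k p n) ℝ) ×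
        (Times 1 T → Matrix (Fin n') (Cols k' (p' + q') n') ℝ)), MeasurableSet B →
      (M.riskNeutral θ μ)⟦{ω | (fun t : Times 1 T => M.PiAt t ω, fun t : Times 1 T => M.GamAt t ω) ∈ B} |
          M.F0 ⊔ M.sigmaRegimes T ⊔ M.sigmaTrans⟧ =ᵐ[μ]
        μ⟦{ω | (fun t : Times 1 T => M.PiAt t ω, fun t : Times 1 T => M.GamAt t ω) ∈ B} |
          M.F0 ⊔ M.sigmaRegimes T⟧) := by
  have hQ := hM.isProbabilityMeasure_riskNeutral hθ
  have hle : M.F0 ⊔ M.sigmaRegimes T ⊔ M.sigmaTrans ≤ M.H 0 :=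
    sup_le (sup_le (M.F0_le_H 0) (M.sigmaRegimes_le_H 0)) (M.sigmaTrans_le_H 0)
  -- The law of the whole vector y is that of the past block at t = T.
  refine ⟨hQ, hM.condGaussian_past hθ (Finset.mem_Icc.2 ⟨by omega, le_rfl⟩),
    fun t ht => ⟨hM.condGaussian_past hθ ht, hM.condGaussian_future_initial hθ ht,
      hM.condGaussian_future hθ ht⟩, fun t ht => hM.condGaussian_step hθ ht,
    fun B hB => ?_, fun B hB => ?_, fun B hB => ?_⟩
  · have hmeas : Measurable[M.H 0] fun ω => (M.sVec ω, M.trans ω) :=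
      (MSVAR.measurable_sVec.mono (M.sigmaRegimes_le_H 0) le_rfl).prodMk
        ((comap_measurable M.trans).mono (M.sigmaTrans_le_H 0) le_rfl)
    exact hM.condExp_riskNeutral_ae_eq hθ (M.F0_le_H 0) (hmeas hB)
  · have hmeas : Measurable[M.sigmaCoeff] fun ω => (fun j => M.Pi j ω, fun j => M.Gam j ω) :=
      (@measurable_pi_lambda _ _ _ M.sigmaCoeff _ _ M.measurable_Pi_sigmaCoeff).prodMk
        (@measurable_pi_lambda _ _ _ M.sigmaCoeff _ _ M.measurable_Gam_sigmaCoeff)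
    exact (hM.condExp_riskNeutral_ae_eq hθ hle (M.sigmaCoeff_le_H 0 _ (hmeas hB))).trans
      (hM.condExp_coeff_ae_eq (hmeas hB))
  -- Along a fixed regime path σ the stacked matrices are functions of the coefficients alone, so
  -- the transition matrix drops out of the conditioning. The actual path takes finitely many values
  -- and is part of the conditioning.
  · have hmeas : ∀ σ : Times 1 T → Fin N, Measurable[M.sigmaCoeff] fun ω =>
        ((fun t : Times 1 T => M.Pi (σ t) ω), (fun t : Times 1 T => M.Gam (σ t) ω)) := fun σ =>
      (@measurable_pi_lambda _ _ _ M.sigmaCoeff _ _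
        fun t : Times 1 T => M.measurable_Pi_sigmaCoeff (σ t)).prodMk
        (@measurable_pi_lambda _ _ _ M.sigmaCoeff _ _
          fun t : Times 1 T => M.measurable_Gam_sigmaCoeff (σ t))
    have hmeasH : Measurable[M.H 0] fun ω =>
        ((fun t : Times 1 T => M.PiAt t ω), (fun t : Times 1 T => M.GamAt t ω)) :=
      (@measurable_pi_lambda _ _ _ (M.H 0) _ _
        fun t : Times 1 T => M.measurable_PiAt_H 0 t.2).prodMk
        (@measurable_pi_lambda _ _ _ (M.H 0) _ _
          fun t : Times 1 T => M.measurable_GamAt_H 0 t.2)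
    refine (hM.condExp_riskNeutral_ae_eq hθ hle (hmeasH hB)).trans ?_
    exact condExp_indicator_ae_eq_of_finite (s := M.sVec)
      (A := fun σ => {ω | ((fun t : Times 1 T => M.Pi (σ t) ω),
        (fun t : Times 1 T => M.Gam (σ t) ω)) ∈ B}) le_sup_left
      (hle.trans (hM.H_le 0)) (MSVAR.measurable_sVec.mono le_sup_right le_rfl)
      (fun σ => hM.sigmaCoeff_le _ (hmeas σ hB)) fun σ => hM.condExp_coeff_ae_eq (hmeas σ hB)
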